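/- Let $\mu$ be an absolutely continuous probability measure on $\mathbb R$ whose support is $[0,1]$, with distribution function $F_\mu$ and quantile function $F_\mu^{[-1]}(p)=\inf\{x\in[0,1]: F_\mu(x)\ge p\}$, and let $q_1,q_2\ge 0$ be capacities with $Q:=q_1+q_2<1$. For $q\in\{q_1,q_2\}$ and $y\in[0,1]$ there is a unique $r\ge 0$ with $\mu([y-r,y+r])=q$; denote it by $R_{\mu,q}(y)$. For $y_1\le y_2$ in $[0,1]$ consider the two-facility radius system in $R_1,R_2\ge 0$ \begin{align*} \mu\Big(\Big[y_1-R_1,\ \min\big\{\max\{\tfrac{y_1+y_2}{2},\,y_2-R_2\},\,y_1+R_1\big\}\Big]\Big)&=q_1,\\ \mu\Big(\Big[\max\big\{\min\{y_1+R_1,\,\tfrac{y_1+y_2}{2}\},\,y_2-R_2\big\},\ y_2+R_2\Big]\Big)&=q_2, \end{align*} and, for $y_2<y_1$, the system obtained by swapping the two facilities. (1) If $y_1,y_2\in[0,1]$ satisfy $F_\mu(y_2)-F_\mu(y_1)\ge q_1+q_2$, then $(R_{\mu,q_1}(y_1),R_{\mu,q_2}(y_2))$ solves this system, and if $q_1,q_2>0$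 it is the only solution; that is, $\vec R_{\mu,\vec q}(y_1,y_2)=(R_{\mu,q_1}(y_1),R_{\mu,q_2}(y_2))$. (2) For $\vec x\in[0,1]^n$ and facilities at $y_1,y_2$, in the First-Come-First-Served game every agent selects one facility; among the agents that selected facility $j$, the $\lfloor q_jn\rfloor$ closest to $y_j$ (equal distances being resolved by the agents' labels) are accommodated and get utility $1-|x_i-y_j|$, all other agents get $0$. The Social Welfare of a strategy profile is $\frac1n$ times the sum of the utilities. For $\vec p\in[0,1]^2$ the percentile mechanism $\mathcal{PM}_{\vec p}$ places facility $j$ at the $(\lfloor p_j(n-1)\rfloor+1)$-th leftmost agent. It is Equilibrium Stable (ES) if, for every $n\ge1$ and every $\vec x\in[0,1]^n$, all pure Nash equilibria of the game induced by its output have the same Social Welfare. If $p_1\neq p_2$ and $\mathcal{PM}_{\vec p}$ is ES, then a pure Nash equilibrium exists on every instance, and the common equilibrium welfare $SW_{\vec p}$ satisfies, for $X_1,\dots,X_n$ i.i.d. with law $\mu$, $$\lim_{n\to\infty}\mathbb E[SW_{\vec p}(X_1,\dots,X_n)]=Q-\sum_{j=1}^2\int_{B_{R_{\mu,q_j}(y_j)}(y_j)}|x-y_j|\,d\mu,\qquad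 y_j=F_\mu^{[-1]}(p_j),$$ where $B_r(y)=[y-r,y+r]$. -/

import Mathlib

open MeasureTheory ProbabilityTheory Filter Topology

noncomputable section

namespace ScarceFLP

/-! ### The First-Come-First-Served game

`n` agents at positions `x`, `m` facilities at positions `y`; facility `j` can accommodate
`⌊q j * n⌋` agents. A strategy profile `s` assigns to every agent the facility it selects. -/

/-- The number of agents that selected the same facility as agent `i` and are served before `i`:
closer agents come first, equal distances are resolved by the agents' labels. -/
def queueRank {m n : ℕ} (y : Fin m → ℝ) (x : Fin n → ℝ) (s : Fin n → Fin m) (i : Fin n) : ℕ :=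
  (Finset.univ.filter fun k : Fin n =>
    s k = s i ∧ (|x k - y (s i)| < |x i - y (s i)| ∨
      (|x k - y (s i)| = |x i - y (s i)| ∧ k < i))).card

/-- Utility of agent `i`: `1 - |x i - y j|` if it is accommodated by the facility `j` it selected,
`0` otherwise. -/
def utility {m n : ℕ} (q y : Fin m → ℝ) (x : Fin n → ℝ) (s : Fin n → Fin m) (i : Fin n) : ℝ :=
  if queueRank y x s i < ⌊q (s i) * n⌋₊ then 1 - |x i - y (s i)| else 0

/-- Pure Nash equilibria of the game. -/
def IsNash {m n : ℕ} (q y : Fin m → ℝ) (x : Fin n → ℝ) (s : Fin n → Fin m) : Prop :=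
  ∀ (i : Fin n) (j : Fin m), utility q y x (Function.update s i j) i ≤ utility q y x s i

/-- Social Welfare of a strategy profile, normalised by the number of agents. -/
def socialWelfare {m n : ℕ} (q y : Fin m → ℝ) (x : Fin n → ℝ) (s : Fin n → Fin m) : ℝ :=
  (∑ i, utility q y x s i) / n

/-! ### Mechanisms -/

/-- The instances with `n` agents: all positions lie in `[0, 1]`. -/
def cube (n : ℕ) : Set (Fin n → ℝ) := {x | ∀ i, x i ∈ Set.Icc (0 : ℝ) 1}

/-- The percentile mechanism: facility `j` is placed at the `(⌊p j * (n - 1)⌋ + 1)`-th leftmost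
agent, i.e. at the entry of index `⌊p j * (n - 1)⌋` (counted from `0`) of the sorted instance. -/
def percentileMechanism {m n : ℕ} [NeZero n] (p : Fin m → ℝ) (x : Fin n → ℝ) : Fin m → ℝ :=
  fun j => x (Tuple.sort x (Fin.ofNat n ⌊p j * ((n : ℝ) - 1)⌋₊))

/-- A mechanism for `n` agents is Equilibrium Stable if, on every instance, all the Nash equilibria
induced by its output attain the same Social Welfare. -/
def IsEquilibriumStable {m n : ℕ} (q : Fin m → ℝ) (M : (Fin n → ℝ) → (Fin m → ℝ)) : Prop :=
  ∀ x ∈ cube n, ∀ s t : Fin n → Fin m, IsNash q (M x) x s → IsNash q (M x) x t →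
    socialWelfare q (M x) x s = socialWelfare q (M x) x t

/-! ### Radius functions -/

/-- `r` solves the equation `μ([y - r, y + r]) = q`. -/
def IsRadius (μ : Measure ℝ) (q y r : ℝ) : Prop :=
  0 ≤ r ∧ μ.real (Set.Icc (y - r) (y + r)) = q

/-- The one-facility radius function `R_{μ,q}(y)`. -/
def radius (μ : Measure ℝ) (q y : ℝ) : ℝ := sInf {r | IsRadius μ q y r}

/-- `(R₁, R₂)` solves the two-facility system for facilities at `y₁ ≤ y₂`. -/
def IsOrderedTwoRadius (μ : Measure ℝ) (q₁ q₂ y₁ y₂ R₁ R₂ : ℝ) : Prop :=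
  0 ≤ R₁ ∧ 0 ≤ R₂ ∧
  μ.real (Set.Icc (y₁ - R₁) (min (max ((y₁ + y₂) / 2) (y₂ - R₂)) (y₁ + R₁))) = q₁ ∧
  μ.real (Set.Icc (max (min (y₁ + R₁) ((y₁ + y₂) / 2)) (y₂ - R₂)) (y₂ + R₂)) = q₂

/-- `R` solves the system that defines the two-facility radius function at `y`; when `y 1 < y 0`
the roles of the two facilities are swapped. -/
def IsTwoRadius (μ : Measure ℝ) (q y R : Fin 2 → ℝ) : Prop :=
  if y 0 ≤ y 1 then IsOrderedTwoRadius μ (q 0) (q 1) (y 0) (y 1) (R 0) (R 1)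
  else IsOrderedTwoRadius μ (q 1) (q 0) (y 1) (y 0) (R 1) (R 0)

/-- The quantile function `F_μ^{[-1]}` of a measure on `[0, 1]`. -/
def quantile (μ : Measure ℝ) (p : ℝ) : ℝ := sInf {x | x ∈ Set.Icc (0 : ℝ) 1 ∧ p ≤ cdf μ x}

end ScarceFLP

end

/-! Write `F` for the distribution function; it is continuous (no atoms) and strictly increasing on
`[0, 1]` (full support).

Radii. If the balls of masses `q₁` and `q₂` around `y₁ ≤ y₂` overlapped, together they would weigh
at least `F (y₂ + r₂) - F (y₁ - r₁) ≥ F y₂ - F y₁ ≥ q₁ + q₂`. All these inequalities would be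
equalities, and strict monotonicity leaves only degenerate positions, which `Q < 1` or the overlap
itself rules out. So the balls do not overlap, and the midpoint terms drop out of the system
(`add_radius_le_sub_radius`). Conversely, in a solution with overlap the two intervals share an end
point and the same chain of inequalities applies (`isRadius_of_isOrderedTwoRadius`).

Welfare. Stability is used through one consequence: for positive capacities and `p a < p b` it
forces `p b - p a ≥ q a + q b` (`le_percentile_sub_of_isEquilibriumStable`). Otherwise, on a
suitable instance, an agent indifferent between the facilities can trade places with an agent who is
not; both profiles are equilibria and their welfare differs (`exists_isNash_socialWelfare_ne`). Once
the percentiles are that far apart and the positions are distinct, so many agents lie between the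
facilities that nobody is among the `⌊q j * n⌋` closest of both. Every equilibrium then serves
exactly these closest agents at each facility (`utility_eq_of_isNash`), and its welfare is the
explicit function `splitWelfare`. If a capacity is zero, the disjointness is automatic.

Limit. Almost surely the empirical quantiles converge to `y j`, and the served agents differ from
those in the ball of mass `q j` around `y j` by a vanishing fraction
(`tendsto_facility_welfare_ae`). Dominated convergence transfers this to expectations. -/

noncomputable section

namespace ScarceFLP

/-! ### Queues and Nash equilibria -/

/-- Agent `k` comes before agent `i` in the queue of facility `j`. -/
def Precedes {m n : ℕ} (y : Fin m → ℝ) (x : Fin n → ℝ) (j : Fin m) (k i : Fin n) : Prop :=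
  |x k - y j| < |x i - y j| ∨ (|x k - y j| = |x i - y j| ∧ k < i)

instance {m n : ℕ} (y : Fin m → ℝ) (x : Fin n → ℝ) (j : Fin m) (k i : Fin n) :
    Decidable (Precedes y x j k i) := by
  unfold Precedes; infer_instance

/-- The number of agents that come before agent `i` in the queue of facility `j` when everybody
joins that queue. -/
def fullRank {m n : ℕ} (y : Fin m → ℝ) (x : Fin n → ℝ) (j : Fin m) (i : Fin n) : ℕ :=
  (Finset.univ.filter fun k : Fin n => Precedes y x j k i).card

section Queue

variable {m n : ℕ} {q y : Fin m → ℝ} {x : Fin n → ℝ} {s : Fin n → Fin m} {j : Fin m}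
  {i k l : Fin n}

theorem Precedes.irrefl : ¬ Precedes y x j i i := by
  simp [Precedes]

theorem Precedes.ne (h : Precedes y x j k i) : k ≠ i := by
  rintro rfl; exact Precedes.irrefl h

theorem Precedes.trans (h : Precedes y x j l k) (h' : Precedes y x j k i) :
    Precedes y x j l i := by
  unfold Precedes at *
  rcases h with h | ⟨h, h1⟩ <;> rcases h' with h' | ⟨h', h2⟩
  · exact Or.inl (h.trans h')
  · exact Or.inl (h' ▸ h)
  · exact Or.inl (h ▸ h')
  · exact Or.inr ⟨h.trans h', h1.trans h2⟩

theorem Precedes.asymm (h : Precedes y x j k i) : ¬ Precedes y x j i k :=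
  fun h' => Precedes.irrefl (h.trans h')

theorem Precedes.dist_le (h : Precedes y x j k i) : |x k - y j| ≤ |x i - y j| := by
  rcases h with h | h
  · exact h.le
  · exact h.1.le

theorem precedes_total (h : k ≠ i) : Precedes y x j k i ∨ Precedes y x j i k := by
  unfold Precedes
  rcases lt_trichotomy |x k - y j| |x i - y j| with h1 | h1 | h1
  · exact Or.inl (Or.inl h1)
  · rcases lt_or_gt_of_ne h with h2 | h2
    · exact Or.inl (Or.inr ⟨h1, h2⟩)
    · exact Or.inr (Or.inr ⟨h1.symm, h2⟩)
  · exact Or.inr (Or.inl h1)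

theorem queueRank_eq (y : Fin m → ℝ) (x : Fin n → ℝ) (s : Fin n → Fin m) (i : Fin n) :
    queueRank y x s i =
      (Finset.univ.filter fun k => s k = s i ∧ Precedes y x (s i) k i).card := rfl

/-- An agent never precedes itself, so its own deviation does not change the choices of the agents
counted. Deviations can thus be evaluated in the original profile. -/
theorem queueRank_update (y : Fin m → ℝ) (x : Fin n → ℝ) (s : Fin n → Fin m) (i : Fin n)
    (j : Fin m) :
    queueRank y x (Function.update s i j) i =
      (Finset.univ.filter fun k => s k = j ∧ Precedes y x j k i).card := by
  rw [queueRank_eq]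
  congr 1
  ext k
  simp only [Function.update_self, Finset.mem_filter, Finset.mem_univ, true_and]
  constructor
  · rintro ⟨h, hp⟩
    exact ⟨by rwa [Function.update_of_ne hp.ne] at h, hp⟩
  · rintro ⟨h, hp⟩
    exact ⟨by rwa [Function.update_of_ne hp.ne], hp⟩

theorem utility_update (q y : Fin m → ℝ) (x : Fin n → ℝ) (s : Fin n → Fin m) (i : Fin n)
    (j : Fin m) :
    utility q y x (Function.update s i j) i =
      if (Finset.univ.filter fun k => s k = j ∧ Precedes y x j k i).card < ⌊q j * n⌋₊
      then 1 - |x i - y j| else 0 := by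
  unfold utility
  rw [queueRank_update, Function.update_self]

theorem fullRank_lt_of_precedes (h : Precedes y x j k i) :
    fullRank y x j k < fullRank y x j i := by
  apply Finset.card_lt_card
  refine ⟨fun l hl => ?_, fun hsub => ?_⟩
  · simp only [Finset.mem_filter, Finset.mem_univ, true_and] at hl ⊢
    exact hl.trans h
  · have : k ∈ Finset.univ.filter fun l : Fin n => Precedes y x j l i := by simpa using h
    have := hsub this
    simp only [Finset.mem_filter, Finset.mem_univ, true_and] at this
    exact Precedes.irrefl this

theorem precedes_iff_fullRank_lt : Precedes y x j k i ↔ fullRank y x j k < fullRank y x j i := by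
  refine ⟨fullRank_lt_of_precedes, fun h => ?_⟩
  by_contra hn
  rcases eq_or_ne k i with rfl | hne
  · exact lt_irrefl _ h
  · rcases precedes_total (y := y) (x := x) (j := j) hne with h' | h'
    · exact hn h'
    · exact absurd (fullRank_lt_of_precedes h') (by omega)

theorem fullRank_lt (y : Fin m → ℝ) (x : Fin n → ℝ) (j : Fin m) (i : Fin n) :
    fullRank y x j i < n := by
  have : fullRank y x j i < (Finset.univ : Finset (Fin n)).card := by
    apply Finset.card_lt_card
    refine ⟨Finset.subset_univ _, fun hsub => ?_⟩
    have := hsub (Finset.mem_univ i)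
    simp only [Finset.mem_filter, Finset.mem_univ, true_and] at this
    exact Precedes.irrefl this
  simpa using this

theorem fullRank_injective (y : Fin m → ℝ) (x : Fin n → ℝ) (j : Fin m) :
    Function.Injective (fullRank y x j) := by
  intro k i h
  by_contra hne
  rcases precedes_total (y := y) (x := x) (j := j) hne with h' | h' <;>
    exact absurd (fullRank_lt_of_precedes h') (by omega)

/-- Exactly `min c n` agents have rank less than `c`. -/
theorem card_fullRank_lt (y : Fin m → ℝ) (x : Fin n → ℝ) (j : Fin m) (c : ℕ) :
    (Finset.univ.filter fun i => fullRank y x j i < c).card = min c n := by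
  -- Ranks are injective with values below `n`, hence a bijection onto `Fin n`.
  let f : Fin n → Fin n := fun i => ⟨fullRank y x j i, fullRank_lt y x j i⟩
  have hf : Function.Bijective f := by
    apply Finite.injective_iff_bijective.mp
    intro a b hab
    exact fullRank_injective y x j (by simpa [f] using hab)
  have h1 : (Finset.univ.filter fun i => fullRank y x j i < c).card =
      (Finset.univ.filter fun r : Fin n => (r : ℕ) < c).card := by
    refine Finset.card_bij (fun i _ => f i) ?_ (fun a _ b _ h => hf.1 h) ?_
    · intro i hi; simpa [f] using hi
    · intro r hr
      obtain ⟨i, rfl⟩ := hf.2 r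
      exact ⟨i, by simpa [f] using hr, rfl⟩
  rw [h1, Fin.card_filter_val_lt, min_comm]

theorem queueRank_le_fullRank (y : Fin m → ℝ) (x : Fin n → ℝ) (s : Fin n → Fin m) (i : Fin n) :
    queueRank y x s i ≤ fullRank y x (s i) i := by
  rw [queueRank_eq]
  apply Finset.card_le_card
  intro k hk
  simp only [Finset.mem_filter, Finset.mem_univ, true_and] at hk ⊢
  exact hk.2

theorem card_filter_precedes_le_fullRank (y : Fin m → ℝ) (x : Fin n → ℝ) (s : Fin n → Fin m)
    (i : Fin n) (j : Fin m) :
    (Finset.univ.filter fun k => s k = j ∧ Precedes y x j k i).card ≤ fullRank y x j i := by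
  apply Finset.card_le_card
  intro k hk
  simp only [Finset.mem_filter, Finset.mem_univ, true_and] at hk ⊢
  exact hk.2

end Queue

/-! ### Existence of equilibria -/

section Existence

variable {m n : ℕ}

/-- Agent-facility pairs compared by distance, then by agent label, then by facility. -/
def pairKey (y : Fin m → ℝ) (x : Fin n → ℝ) (a : Fin n × Fin m) : ℝ ×ₗ (Fin n ×ₗ Fin m) :=
  toLex (|x a.1 - y a.2|, toLex (a.1, a.2))

theorem pairKey_wf (y : Fin m → ℝ) (x : Fin n → ℝ) :
    WellFounded fun a b : Fin n × Fin m => pairKey y x a < pairKey y x b := by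
  have : IsTrans (Fin n × Fin m) (fun a b => pairKey y x a < pairKey y x b) :=
    ⟨fun _ _ _ h h' => lt_trans h h'⟩
  have : Std.Irrefl (fun a b : Fin n × Fin m => pairKey y x a < pairKey y x b) :=
    ⟨fun _ => lt_irrefl _⟩
  exact Finite.wellFounded_of_trans_of_irrefl _

/-- The agent label is the second component of the key so that, within one facility, the greedy
order is the queue order. -/
theorem pairKey_lt_same_facility (y : Fin m → ℝ) (x : Fin n → ℝ) (j : Fin m) (k i : Fin n) :
    pairKey y x (k, j) < pairKey y x (i, j) ↔ Precedes y x j k i := by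
  simp [pairKey, Precedes, Prod.Lex.toLex_lt_toLex]

open Classical in
/-- The greedy assignment: pairs are visited in the order of `pairKey`, and a pair is accepted if
its agent is not assigned yet and its facility still has a free place. -/
theorem exists_greedy (c : Fin m → ℕ) (y : Fin m → ℝ) (x : Fin n → ℝ) :
    ∃ P : Fin n × Fin m → Prop, ∀ a, P a ↔
      (¬ ∃ j, pairKey y x (a.1, j) < pairKey y x a ∧ P (a.1, j)) ∧
      (Finset.univ.filter fun k =>
        pairKey y x (k, a.2) < pairKey y x a ∧ P (k, a.2)).card < c a.2 := by
  let F : (a : Fin n × Fin m) →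
      ((b : Fin n × Fin m) → pairKey y x b < pairKey y x a → Prop) → Prop :=
    fun a P => (¬ ∃ j, ∃ h : pairKey y x (a.1, j) < pairKey y x a, P (a.1, j) h) ∧
      (Finset.univ.filter fun k =>
        ∃ h : pairKey y x (k, a.2) < pairKey y x a, P (k, a.2) h).card < c a.2
  refine ⟨(pairKey_wf y x).fix F, fun a => ?_⟩
  rw [WellFounded.fix_eq]
  simp only [F, exists_prop]

/-- The First-Come-First-Served game has a pure Nash equilibrium as soon as no agent is at
distance more than `1` from a facility. -/
theorem exists_isNash [NeZero m] (q y : Fin m → ℝ) (x : Fin n → ℝ)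
    (hd : ∀ i j, |x i - y j| ≤ 1) : ∃ s, IsNash q y x s := by
  classical
  obtain ⟨P, hP⟩ := exists_greedy (fun j => ⌊q j * n⌋₊) y x
  -- Agents left out by the greedy rule select facility `0` by default; it is shown below that they
  -- never stand ahead of an accepted agent there.
  let s : Fin n → Fin m := fun i => if h : ∃ j, P (i, j) then h.choose else 0
  have hs : ∀ i, (∃ j, P (i, j)) → P (i, s i) := by
    intro i h
    simp only [s, h, dite_true]
    exact h.choose_spec
  have huniq : ∀ i j, P (i, j) → s i = j := by
    intro i j h
    by_contra hne
    have h' := hs i ⟨j, h⟩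
    have hk : pairKey y x (i, s i) ≠ pairKey y x (i, j) := by
      intro he
      simp only [pairKey, EmbeddingLike.apply_eq_iff_eq, Prod.mk.injEq] at he
      exact hne he.2.2
    rcases lt_or_gt_of_ne hk with hlt | hlt
    · exact ((hP (i, j)).1 h).1 ⟨s i, hlt, h'⟩
    · exact ((hP (i, s i)).1 h').1 ⟨j, hlt, h⟩
  refine ⟨s, fun i j => ?_⟩
  have h0 : 0 ≤ utility q y x s i := by
    unfold utility; split_ifs
    · linarith [hd i (s i)]
    · exact le_rfl
  -- All places of `j` are taken by accepted agents ahead of `i`, and each of them selects `j`, so a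
  -- move of `i` to `j` earns nothing.
  have hfull : ∀ i j, ⌊q j * n⌋₊ ≤ (Finset.univ.filter fun k =>
      pairKey y x (k, j) < pairKey y x (i, j) ∧ P (k, j)).card →
      utility q y x (Function.update s i j) i = 0 := by
    intro i j hc
    rw [utility_update, if_neg]
    rw [not_lt]
    refine hc.trans (Finset.card_le_card fun k hk => ?_)
    simp only [Finset.mem_filter, Finset.mem_univ, true_and, pairKey_lt_same_facility] at hk ⊢
    exact ⟨huniq k j hk.2, hk.1⟩
  by_cases hex : ∃ j, P (i, j)
  · have hi := hs i hex
    have hserved : utility q y x s i = 1 - |x i - y (s i)| := by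
      unfold utility
      rw [if_pos]
      refine lt_of_le_of_lt ?_ ((hP (i, s i)).1 hi).2
      rw [queueRank_eq]
      refine Finset.card_le_card fun k hk => ?_
      simp only [Finset.mem_filter, Finset.mem_univ, true_and, pairKey_lt_same_facility] at hk ⊢
      refine ⟨hk.2, ?_⟩
      by_contra hkn
      -- an agent without a place that is ahead of `i` would have been accepted
      by_cases hkj : ∃ j, P (k, j)
      · exact hkn (hk.1 ▸ hs k hkj)
      · refine hkn ((hP (k, s i)).2 ⟨fun ⟨j, _, hj⟩ => hkj ⟨j, hj⟩, ?_⟩)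
        refine lt_of_le_of_lt (Finset.card_le_card fun l hl => ?_) ((hP (i, s i)).1 hi).2
        simp only [Finset.mem_filter, Finset.mem_univ, true_and, pairKey_lt_same_facility] at hl ⊢
        exact ⟨hl.1.trans hk.2, hl.2⟩
    by_cases hd' : |x i - y (s i)| ≤ |x i - y j|
    · rw [hserved, utility_update]
      split_ifs
      · linarith
      · linarith [hd i (s i)]
    -- A strictly closer `j` was offered to `i` before `s i`, while `i` was unassigned; only a full
    -- queue can explain the rejection.
    · have hlt : pairKey y x (i, j) < pairKey y x (i, s i) := by
        simp only [pairKey, Prod.Lex.toLex_lt_toLex]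
        exact Or.inl (not_le.1 hd')
      rw [hfull i j]
      · exact h0
      · by_contra hc
        have hj : P (i, j) := by
          refine (hP (i, j)).2 ⟨?_, not_le.1 hc⟩
          rintro ⟨l, hl, hPl⟩
          rw [← huniq i l hPl] at hl
          exact lt_asymm hl hlt
        rw [huniq i j hj] at hd'
        exact hd' le_rfl
  · rw [hfull i j]
    · exact h0
    · by_contra hc
      exact hex ⟨j, (hP (i, j)).2 ⟨fun ⟨l, _, hl⟩ => hex ⟨l, hl⟩, not_le.1 hc⟩⟩

end Existence

/-! ### Equilibria when the facilities do not compete -/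

/-- The utility of agent `i` when it is served by every facility whose `⌊q j * n⌋` closest agents
contain it. -/
def splitUtility {m n : ℕ} (q y : Fin m → ℝ) (x : Fin n → ℝ) (j : Fin m) (i : Fin n) : ℝ :=
  if fullRank y x j i < ⌊q j * n⌋₊ then 1 - |x i - y j| else 0

/-- Suppose `i`, among the closest of `a`, selects the other facility. Then it is served there
without belonging to the closest of that facility, so some `k` among those closest has gone to `a`.
Since `k` weakly prefers `a` and `i` weakly prefers its own choice, `k` also precedes `i` at `a`,
and `k` is among the closest of both facilities, against `hdisj`. The strict bound `hd` makes being
served worth a positive utility. -/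
theorem utility_eq_of_isNash {n : ℕ} {q y : Fin 2 → ℝ} {x : Fin n → ℝ} {s : Fin n → Fin 2}
    (hd : ∀ i j, |x i - y j| < 1)
    (hdisj : ∀ i a b, a ≠ b → fullRank y x a i < ⌊q a * n⌋₊ → ¬ fullRank y x b i < ⌊q b * n⌋₊)
    (hs : IsNash q y x s) (i : Fin n) :
    utility q y x s i = ∑ j, splitUtility q y x j i := by
  -- an agent among the first of `a` that selects `b` is served there and does not lose
  have hother : ∀ i a, fullRank y x a i < ⌊q a * n⌋₊ → s i ≠ a →
      |x i - y (s i)| ≤ |x i - y a| := by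
    intro i a hi hne
    have h := hs i a
    rw [utility_update, if_pos ((card_filter_precedes_le_fullRank y x s i a).trans_lt hi)] at h
    unfold utility at h
    split_ifs at h
    · linarith
    · linarith [hd i a]
  have hown : ∀ i a, fullRank y x a i < ⌊q a * n⌋₊ → s i = a := by
    intro i a hi
    by_contra hne
    have hib : ¬ fullRank y x (s i) i < ⌊q (s i) * n⌋₊ := hdisj i a (s i) (Ne.symm hne) hi
    -- agent `i` is served at `s i`
    have hserved : queueRank y x s i < ⌊q (s i) * n⌋₊ := by
      have h := hs i a
      rw [utility_update, if_pos ((card_filter_precedes_le_fullRank y x s i a).trans_lt hi)] at h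
      unfold utility at h
      split_ifs at h with h1
      · exact h1
      · linarith [hd i a]
    -- some agent ahead of `i` among the first of `s i` selects `a`
    obtain ⟨k, hk, hka⟩ : ∃ k, fullRank y x (s i) k < ⌊q (s i) * n⌋₊ ∧ s k ≠ s i := by
      by_contra hcon
      push Not at hcon
      have hle : (Finset.univ.filter fun k => fullRank y x (s i) k < ⌊q (s i) * n⌋₊).card ≤
          queueRank y x s i := by
        rw [queueRank_eq]
        refine Finset.card_le_card fun k hk => ?_
        simp only [Finset.mem_filter, Finset.mem_univ, true_and] at hk ⊢
        exact ⟨hcon k hk, precedes_iff_fullRank_lt.2 (by omega)⟩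
      rw [card_fullRank_lt] at hle
      have := fullRank_lt y x (s i) i
      omega
    have hpre : Precedes y x (s i) k i := precedes_iff_fullRank_lt.2 (by omega)
    -- With only two facilities, not selecting `s i` means selecting `a`.
    have hsk : s k = a := by
      have h1 := hka; have h2 := hne
      generalize s k = u at *; generalize s i = v at *
      fin_cases u <;> fin_cases v <;> fin_cases a <;> simp_all
    have h1 : |x k - y a| ≤ |x k - y (s i)| := hsk ▸ hother k (s i) hk hka
    have h2 := hpre.dist_le
    have h3 := hother i a hi hne
    -- Distances satisfy `k` to `a` ≤ `k` to `s i` ≤ `i` to `s i` ≤ `i` to `a`. If equality holds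
    -- throughout, the label order from the queue of `s i` decides at `a` as well.
    have hpre' : Precedes y x a k i := by
      rcases hpre with hp | hp
      · exact Or.inl (by linarith)
      · rcases lt_or_eq_of_le (h1.trans (h2.trans h3)) with h4 | h4
        · exact Or.inl h4
        · exact Or.inr ⟨h4, hp.2⟩
    exact hdisj k a (s i) (Ne.symm hne) ((fullRank_lt_of_precedes hpre').trans hi) hk
  by_cases hex : ∃ a, fullRank y x a i < ⌊q a * n⌋₊
  · obtain ⟨a, ha⟩ := hex
    rw [Finset.sum_eq_single a]
    · have := hown i a ha
      unfold utility splitUtility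
      rw [if_pos ha, if_pos, this]
      rw [this]
      exact (queueRank_le_fullRank y x s i).trans_lt (this ▸ ha)
    · intro b _ hb
      exact if_neg (hdisj i a b hb.symm ha)
    · simp
  · push Not at hex
    have h0 : ∀ j, splitUtility q y x j i = 0 := fun j => if_neg (not_lt.2 (hex j))
    rw [Finset.sum_eq_zero fun j _ => h0 j]
    unfold utility
    rw [if_neg]
    rw [not_lt, queueRank_eq]
    -- The closest agents of `s i` all select it, precede `i`, and fill every place.
    have h1 := card_fullRank_lt y x (s i) ⌊q (s i) * n⌋₊
    rw [min_eq_left ((hex (s i)).trans (fullRank_lt y x (s i) i).le)] at h1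
    rw [← h1]
    refine Finset.card_le_card fun k hk => ?_
    simp only [Finset.mem_filter, Finset.mem_univ, true_and] at hk ⊢
    exact ⟨hown k _ hk, precedes_iff_fullRank_lt.2 (hk.trans_le (hex _))⟩

/-! ### Equilibrium stability forces the percentiles apart -/

section Exchange

variable {n : ℕ}

open Classical in
/-- The profile in which exactly the agents of `S` select `f` and all others select `g`. -/
def twoProfile (f g : Fin 2) (S : Finset (Fin n)) (i : Fin n) : Fin 2 := if i ∈ S then f else g

theorem twoProfile_eq_left {f g : Fin 2} (hfg : f ≠ g) {S : Finset (Fin n)} {i : Fin n} :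
    twoProfile f g S i = f ↔ i ∈ S := by
  unfold twoProfile; split_ifs with h <;> simp [h, hfg.symm]

theorem twoProfile_eq_right {f g : Fin 2} (hfg : f ≠ g) {S : Finset (Fin n)} {i : Fin n} :
    twoProfile f g S i = g ↔ i ∉ S := by
  unfold twoProfile; split_ifs with h <;> simp [h, hfg]

theorem twoProfile_of_mem {f g : Fin 2} {S : Finset (Fin n)} {i : Fin n} (h : i ∈ S) :
    twoProfile f g S i = f := if_pos h

theorem twoProfile_of_notMem {f g : Fin 2} {S : Finset (Fin n)} {i : Fin n} (h : i ∉ S) :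
    twoProfile f g S i = g := if_neg h

theorem utility_twoProfile_of_mem {q y : Fin 2 → ℝ} {x : Fin n → ℝ} {f g : Fin 2} (hfg : f ≠ g)
    {S : Finset (Fin n)} (hS : S.card ≤ ⌊q f * n⌋₊) {i : Fin n} (hi : i ∈ S) :
    utility q y x (twoProfile f g S) i = 1 - |x i - y f| := by
  unfold utility
  rw [queueRank_eq, twoProfile_of_mem hi, if_pos]
  refine lt_of_lt_of_le (Finset.card_lt_card ⟨fun k hk => ?_, fun hsub => ?_⟩) hS
  · simp only [Finset.mem_filter, Finset.mem_univ, true_and, twoProfile_eq_left hfg] at hk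
    exact hk.1
  · have := hsub hi
    simp only [Finset.mem_filter, Finset.mem_univ, true_and] at this
    exact Precedes.irrefl this.2

theorem utility_twoProfile_of_notMem {q y : Fin 2 → ℝ} {x : Fin n → ℝ} {f g : Fin 2} (hfg : f ≠ g)
    {S : Finset (Fin n)} {i : Fin n} (hi : i ∉ S) :
    utility q y x (twoProfile f g S) i =
      if (Finset.univ.filter fun k => k ∉ S ∧ Precedes y x g k i).card < ⌊q g * n⌋₊
      then 1 - |x i - y g| else 0 := by
  unfold utility
  rw [queueRank_eq, twoProfile_of_notMem hi]
  simp only [twoProfile_eq_right hfg]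

/-- If `f` is filled by `S`, every agent of `S` prefers `f`, and every other agent either is served
by `g`, which it prefers, or comes after all of `S` in the queue of `f`, then the profile is an
equilibrium. -/
theorem isNash_twoProfile {q y : Fin 2 → ℝ} {x : Fin n → ℝ} {f g : Fin 2} (hfg : f ≠ g)
    (hd : ∀ i j, |x i - y j| ≤ 1)
    {S : Finset (Fin n)} (hS : S.card = ⌊q f * n⌋₊)
    (hpref : ∀ i ∈ S, |x i - y f| ≤ |x i - y g|)
    (hrest : ∀ i ∉ S, (|x i - y g| ≤ |x i - y f| ∧
        (Finset.univ.filter fun k => k ∉ S ∧ Precedes y x g k i).card < ⌊q g * n⌋₊) ∨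
      ∀ k ∈ S, Precedes y x f k i) :
    IsNash q y x (twoProfile f g S) := by
  have h0 : ∀ i, 0 ≤ utility q y x (twoProfile f g S) i := by
    intro i; unfold utility; split_ifs
    · linarith [hd i (twoProfile f g S i)]
    · exact le_rfl
  intro i j
  by_cases hj : j = twoProfile f g S i
  · rw [hj, Function.update_eq_self]
  by_cases hi : i ∈ S
  · rw [utility_twoProfile_of_mem hfg hS.le hi, utility_update]
    rw [twoProfile_of_mem hi] at hj
    have hjg : j = g := by
      fin_cases j <;> fin_cases f <;> fin_cases g <;> simp_all
    subst hjg
    split_ifs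
    · linarith [hpref i hi]
    · linarith [hd i f]
  · rw [twoProfile_of_notMem hi] at hj
    have hjf : j = f := by
      fin_cases j <;> fin_cases f <;> fin_cases g <;> simp_all
    subst hjf
    rcases hrest i hi with ⟨h1, h2⟩ | h1
    · rw [utility_twoProfile_of_notMem hfg hi, if_pos h2, utility_update]
      split_ifs
      · linarith
      · linarith [hd i g]
    · rw [utility_update, if_neg]
      · exact h0 i
      · rw [not_lt, ← hS]
        refine Finset.card_le_card fun k hk => ?_
        simp only [Finset.mem_filter, Finset.mem_univ, true_and, twoProfile_eq_left hfg]
        exact ⟨hk, h1 k hk⟩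

/-- Exchanging the indifferent agent `a` for the agent `e`, which prefers `f`, yields two equilibria
with different welfare. -/
theorem exists_isNash_socialWelfare_ne {q y : Fin 2 → ℝ} {x : Fin n → ℝ} {f g : Fin 2}
    (hfg : f ≠ g) (hd : ∀ i j, |x i - y j| ≤ 1) {F K : Finset (Fin n)} {a e : Fin n}
    (hae : a ≠ e) (haF : a ∉ F) (heF : e ∉ F) (haK : a ∉ K) (heK : e ∉ K) (hFK : Disjoint F K)
    (hF : F.card + 1 = ⌊q f * n⌋₊) (hK : K.card + 1 ≤ ⌊q g * n⌋₊)
    (hprefF : ∀ i ∈ F, |x i - y f| ≤ |x i - y g|)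
    (hprefK : ∀ i ∈ K, |x i - y g| ≤ |x i - y f|)
    (ha : |x a - y f| = |x a - y g|) (he : |x e - y f| < |x e - y g|)
    (hFe : ∀ k ∈ F, Precedes y x f k e) (hae' : Precedes y x f a e)
    (hrestF : ∀ i, i ∉ F → i ∉ K → i ≠ a → i ≠ e →
      Precedes y x f a i ∧ Precedes y x f e i ∧ ∀ k ∈ F, Precedes y x f k i)
    (hrestK : ∀ i, i ∉ F → i ∉ K → i ≠ a → i ≠ e →
      Precedes y x g a i ∧ Precedes y x g e i ∧ ∀ k ∈ K, Precedes y x g k i) :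
    ∃ s t, IsNash q y x s ∧ IsNash q y x t ∧ socialWelfare q y x s ≠ socialWelfare q y x t := by
  classical
  -- the rank at `g` of an agent of `K`, or of the exchanged agent selecting `g`, is below capacity
  have hrank : ∀ b c, b ∉ F → b ∉ K → c ∉ F → c ∉ K → (b = a ∧ c = e ∨ b = e ∧ c = a) →
      ∀ i, (i ∈ K ∨ i = c) →
      (Finset.univ.filter fun k => k ∉ insert b F ∧ Precedes y x g k i).card < ⌊q g * n⌋₊ := by
    intro b c hbF hbK hcF hcK hbc i hi
    -- Ahead of `i` at `g` there can only be agents of `K` and the exchanged agent `c`, minus `i`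
    -- itself: at most `K.card` agents, which is below capacity.
    have hsub : (Finset.univ.filter fun k => k ∉ insert b F ∧ Precedes y x g k i) ⊆
        (insert c K).erase i := by
      intro k hk
      simp only [Finset.mem_filter, Finset.mem_univ, true_and, Finset.mem_insert, not_or] at hk
      obtain ⟨⟨hkb, hkF⟩, hp⟩ := hk
      rw [Finset.mem_erase, Finset.mem_insert]
      refine ⟨hp.ne, ?_⟩
      by_contra hcon
      rw [not_or] at hcon
      have hk' : k ≠ a ∧ k ≠ e := by
        rcases hbc with ⟨rfl, rfl⟩ | ⟨rfl, rfl⟩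
        · exact ⟨hkb, hcon.1⟩
        · exact ⟨hcon.1, hkb⟩
      obtain ⟨r1, r2, r3⟩ := hrestK k hkF hcon.2 hk'.1 hk'.2
      rcases hi with hi | hi
      · exact (r3 i hi).asymm hp
      · rcases hbc with ⟨rfl, rfl⟩ | ⟨rfl, rfl⟩
        · exact r2.asymm (hi ▸ hp)
        · exact r1.asymm (hi ▸ hp)
    have hmem : i ∈ insert c K := by
      rcases hi with hi | hi <;> simp [hi]
    have h1 := Finset.card_le_card hsub
    rw [Finset.card_erase_of_mem hmem, Finset.card_insert_of_notMem hcK] at h1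
    omega
  have hcard : ∀ b, b ∉ F → (insert b F).card = ⌊q f * n⌋₊ := fun b hb => by
    rw [Finset.card_insert_of_notMem hb, hF]
  have hKF : ∀ i ∈ K, i ∉ F := fun i hi hi' => Finset.disjoint_left.1 hFK hi' hi
  have hs : IsNash q y x (twoProfile f g (insert a F)) := by
    refine isNash_twoProfile hfg hd (hcard a haF) ?_ ?_
    · intro i hi
      rcases Finset.mem_insert.1 hi with rfl | hi
      · exact ha.le
      · exact hprefF i hi
    · intro i hi
      rw [Finset.mem_insert, not_or] at hi
      by_cases hiK : i ∈ K
      · exact Or.inl ⟨hprefK i hiK, hrank a e haF haK heF heK (Or.inl ⟨rfl, rfl⟩) i (Or.inl hiK)⟩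
      · right
        intro k hk
        rcases eq_or_ne i e with rfl | hie
        · rcases Finset.mem_insert.1 hk with rfl | hk
          · exact hae'
          · exact hFe k hk
        · obtain ⟨r1, r2, r3⟩ := hrestF i hi.2 hiK hi.1 hie
          rcases Finset.mem_insert.1 hk with rfl | hk
          · exact r1
          · exact r3 k hk
  have ht : IsNash q y x (twoProfile f g (insert e F)) := by
    refine isNash_twoProfile hfg hd (hcard e heF) ?_ ?_
    · intro i hi
      rcases Finset.mem_insert.1 hi with rfl | hi
      · exact he.le
      · exact hprefF i hi
    · intro i hi
      rw [Finset.mem_insert, not_or] at hi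
      by_cases hiK : i ∈ K
      · exact Or.inl ⟨hprefK i hiK, hrank e a heF heK haF haK (Or.inr ⟨rfl, rfl⟩) i (Or.inl hiK)⟩
      · rcases eq_or_ne i a with rfl | hia
        · exact Or.inl ⟨ha.ge, hrank e i heF heK haF haK (Or.inr ⟨rfl, rfl⟩) i (Or.inr rfl)⟩
        · right
          intro k hk
          obtain ⟨r1, r2, r3⟩ := hrestF i hi.2 hiK hia hi.1
          rcases Finset.mem_insert.1 hk with rfl | hk
          · exact r2
          · exact r3 k hk
  refine ⟨_, _, hs, ht, ?_⟩
  have hn : (n : ℝ) ≠ 0 := by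
    have : 0 < n := lt_of_le_of_lt (Nat.zero_le _) a.2
    exact_mod_cast this.ne'
  -- Only `e` changes its utility: `a` is indifferent, and the others keep their facility and their
  -- service status.
  have hlt : ∑ i, utility q y x (twoProfile f g (insert a F)) i <
      ∑ i, utility q y x (twoProfile f g (insert e F)) i := by
    refine Finset.sum_lt_sum (fun i _ => ?_) ⟨e, Finset.mem_univ e, ?_⟩
    · by_cases hiF : i ∈ F
      · rw [utility_twoProfile_of_mem hfg (hcard a haF).le (Finset.mem_insert_of_mem hiF),
          utility_twoProfile_of_mem hfg (hcard e heF).le (Finset.mem_insert_of_mem hiF)]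
      rcases eq_or_ne i a with rfl | hia
      · rw [utility_twoProfile_of_mem hfg (hcard i haF).le (Finset.mem_insert_self i F),
          utility_twoProfile_of_notMem hfg (by simp [hae, haF]),
          if_pos (hrank e i heF heK haF haK (Or.inr ⟨rfl, rfl⟩) i (Or.inr rfl)), ha]
      rcases eq_or_ne i e with rfl | hie
      · rw [utility_twoProfile_of_mem hfg (hcard i heF).le (Finset.mem_insert_self i F),
          utility_twoProfile_of_notMem hfg (by simp [hia, heF])]
        split_ifs
        · linarith
        · linarith [hd i f]
      have hia' : i ∉ insert a F := by simp [hia, hiF]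
      have hie' : i ∉ insert e F := by simp [hie, hiF]
      rw [utility_twoProfile_of_notMem hfg hia', utility_twoProfile_of_notMem hfg hie']
      by_cases hiK : i ∈ K
      · rw [if_pos (hrank a e haF haK heF heK (Or.inl ⟨rfl, rfl⟩) i (Or.inl hiK)),
          if_pos (hrank e a heF heK haF haK (Or.inr ⟨rfl, rfl⟩) i (Or.inl hiK))]
      · obtain ⟨r1, r2, _⟩ := hrestK i hiF hiK hia hie
        -- Exactly one of `a` and `e` waits at `g` in either profile, and both precede `i`; the
        -- number of agents ahead of `i` is the same.
        have hset : ∀ b c, b ∉ F → c ∉ F → b ≠ c → Precedes y x g c i →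
            (Finset.univ.filter fun k => k ∉ insert b F ∧ Precedes y x g k i) =
            insert c (Finset.univ.filter fun k =>
              k ∉ insert b (insert c F) ∧ Precedes y x g k i) := by
          intro b c hb hc hbc hp
          ext k
          simp only [Finset.mem_filter, Finset.mem_univ, true_and, Finset.mem_insert, not_or]
          constructor
          · rintro ⟨h1, h2⟩
            by_cases hkc : k = c
            · exact Or.inl hkc
            · exact Or.inr ⟨⟨h1.1, hkc, h1.2⟩, h2⟩
          · rintro (rfl | ⟨h1, h2⟩)
            · exact ⟨⟨hbc.symm, hc⟩, hp⟩
            · exact ⟨⟨h1.1, h1.2.2⟩, h2⟩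
        rw [hset a e haF heF hae r2, hset e a heF haF hae.symm r1, Finset.card_insert_of_notMem,
          Finset.card_insert_of_notMem, Finset.insert_comm a e F] <;> simp
    · rw [utility_twoProfile_of_mem hfg (hcard e heF).le (Finset.mem_insert_self e F),
        utility_twoProfile_of_notMem hfg (by simp [hae.symm, heF]),
        if_pos (hrank a e haF haK heF heK (Or.inl ⟨rfl, rfl⟩) e (Or.inr rfl))]
      linarith
  unfold socialWelfare
  intro heq
  rw [div_left_inj' hn] at heq
  exact hlt.ne heq

end Exchange

/-! An instance with two welfare levels: `l` agents at `0`, `u` at `2/10`, one at `3/10`,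
`v` at `4/10` and the others at `9/10`. -/

/-- The positions of the agents, by their label. -/
def exchangeInstance (l u v n : ℕ) (i : Fin n) : ℝ :=
  if (i : ℕ) < l then 0 else if (i : ℕ) < l + u then 2 / 10 else if (i : ℕ) = l + u then 3 / 10
  else if (i : ℕ) ≤ l + u + v then 4 / 10 else 9 / 10

theorem exchangeInstance_cases (l u v n : ℕ) (i : Fin n) :
    ((i : ℕ) < l ∧ exchangeInstance l u v n i = 0) ∨
    (l ≤ i ∧ (i : ℕ) < l + u ∧ exchangeInstance l u v n i = 2 / 10) ∨
    ((i : ℕ) = l + u ∧ exchangeInstance l u v n i = 3 / 10) ∨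
    (l + u < i ∧ (i : ℕ) ≤ l + u + v ∧ exchangeInstance l u v n i = 4 / 10) ∨
    (l + u + v < i ∧ exchangeInstance l u v n i = 9 / 10) := by
  unfold exchangeInstance
  split_ifs <;> simp <;> omega

theorem monotone_exchangeInstance (l u v n : ℕ) : Monotone (exchangeInstance l u v n) := by
  intro i k h
  have h' : (i : ℕ) ≤ k := h
  rcases exchangeInstance_cases l u v n i with hi | hi | hi | hi | hi <;>
  rcases exchangeInstance_cases l u v n k with hk | hk | hk | hk | hk <;>
  first
  | (exfalso; omega)
  | (simp only [hi, hk]; norm_num)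

theorem exchangeInstance_mem_cube (l u v n : ℕ) : exchangeInstance l u v n ∈ cube n := by
  intro i
  rcases exchangeInstance_cases l u v n i with hi | hi | hi | hi | hi <;> simp only [hi] <;>
  norm_num

theorem percentileMechanism_of_monotone {m n : ℕ} [NeZero n] (p : Fin m → ℝ) {x : Fin n → ℝ}
    (hx : Monotone x) (j : Fin m) :
    percentileMechanism p x j = x (Fin.ofNat n ⌊p j * ((n : ℝ) - 1)⌋₊) := by
  unfold percentileMechanism
  rw [Tuple.sort_eq_refl_iff_monotone.2 hx]
  rfl

theorem card_filter_val_Ico {n : ℕ} {a b : ℕ} (hb : b ≤ n) :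
    (Finset.univ.filter fun i : Fin n => a ≤ (i : ℕ) ∧ (i : ℕ) < b).card = b - a := by
  rw [← Nat.card_Ico a b]
  refine Finset.card_bij (fun i _ => (i : ℕ)) ?_ (fun i _ k _ h => Fin.ext h) ?_
  · intro i hi; simpa using hi
  · intro k hk
    rw [Finset.mem_Ico] at hk
    exact ⟨⟨k, by omega⟩, by simpa using hk, rfl⟩

/-- Ten times the distance of the agents of the instance to the facility at `2/10`. -/
def exchangeDistLeft (l u v i : ℕ) : ℕ :=
  if i < l then 2 else if i < l + u then 0 else if i = l + u then 1
  else if i ≤ l + u + v then 2 else 7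

/-- Ten times the distance of the agents of the instance to the facility at `4/10`. -/
def exchangeDistRight (l u v i : ℕ) : ℕ :=
  if i < l then 4 else if i < l + u then 2 else if i = l + u then 1
  else if i ≤ l + u + v then 0 else 5

/-- Scaled by ten the distances are natural numbers, which turns all comparisons in the queues into
linear arithmetic. -/
theorem abs_exchangeInstance_sub_left (l u v n : ℕ) (i : Fin n) :
    |exchangeInstance l u v n i - 2 / 10| = (exchangeDistLeft l u v i : ℝ) / 10 := by
  unfold exchangeInstance exchangeDistLeft
  split_ifs <;> norm_num [abs_of_pos]

theorem abs_exchangeInstance_sub_right (l u v n : ℕ) (i : Fin n) :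
    |exchangeInstance l u v n i - 4 / 10| = (exchangeDistRight l u v i : ℝ) / 10 := by
  unfold exchangeInstance exchangeDistRight
  split_ifs <;> norm_num [abs_of_pos, abs_of_neg]

/-- The facts about distances and queues in the instance, in terms of natural numbers. -/
theorem exchangeInstance_queue_facts (l u v n : ℕ) {y : Fin 2 → ℝ} {a b : Fin 2}
    (hab : a ≠ b) (hya : y a = 2 / 10) (hyb : y b = 4 / 10) :
    (∀ i j, |exchangeInstance l u v n i - y j| ≤ 1) ∧
    (∀ k i : Fin n, exchangeDistLeft l u v k < exchangeDistLeft l u v i ∨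
      (exchangeDistLeft l u v k = exchangeDistLeft l u v i ∧ (k : ℕ) < i) →
      Precedes y (exchangeInstance l u v n) a k i) ∧
    (∀ k i : Fin n, exchangeDistRight l u v k < exchangeDistRight l u v i ∨
      (exchangeDistRight l u v k = exchangeDistRight l u v i ∧ (k : ℕ) < i) →
      Precedes y (exchangeInstance l u v n) b k i) ∧
    (∀ i : Fin n, exchangeDistLeft l u v i ≤ exchangeDistRight l u v i →
      |exchangeInstance l u v n i - y a| ≤ |exchangeInstance l u v n i - y b|) ∧
    (∀ i : Fin n, exchangeDistRight l u v i ≤ exchangeDistLeft l u v i →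
      |exchangeInstance l u v n i - y b| ≤ |exchangeInstance l u v n i - y a|) ∧
    (∀ i : Fin n, |exchangeInstance l u v n i - y a| = (exchangeDistLeft l u v i : ℝ) / 10) ∧
    (∀ i : Fin n, |exchangeInstance l u v n i - y b| = (exchangeDistRight l u v i : ℝ) / 10) := by
  have hd : ∀ i j, |exchangeInstance l u v n i - y j| ≤ 1 := by
    intro i j
    have hj : j = a ∨ j = b := by
      fin_cases j <;> fin_cases a <;> fin_cases b <;> simp_all
    rcases hj with rfl | rfl <;> rw [abs_le] <;>
    rcases exchangeInstance_cases l u v n i with hi | hi | hi | hi | hi <;>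
    simp only [hi, hya, hyb] <;> norm_num
  have hda : ∀ i : Fin n, |exchangeInstance l u v n i - y a| =
      (exchangeDistLeft l u v i : ℝ) / 10 := fun i => by
    rw [hya, abs_exchangeInstance_sub_left]
  have hdb : ∀ i : Fin n, |exchangeInstance l u v n i - y b| =
      (exchangeDistRight l u v i : ℝ) / 10 := fun i => by
    rw [hyb, abs_exchangeInstance_sub_right]
  have hpa : ∀ k i : Fin n, exchangeDistLeft l u v k < exchangeDistLeft l u v i ∨
      (exchangeDistLeft l u v k = exchangeDistLeft l u v i ∧ (k : ℕ) < i) →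
      Precedes y (exchangeInstance l u v n) a k i := by
    intro k i h
    unfold Precedes
    rw [hda, hda, div_lt_div_iff_of_pos_right (by norm_num), div_left_inj' (by norm_num)]
    exact_mod_cast h
  have hpb : ∀ k i : Fin n, exchangeDistRight l u v k < exchangeDistRight l u v i ∨
      (exchangeDistRight l u v k = exchangeDistRight l u v i ∧ (k : ℕ) < i) →
      Precedes y (exchangeInstance l u v n) b k i := by
    intro k i h
    unfold Precedes
    rw [hdb, hdb, div_lt_div_iff_of_pos_right (by norm_num), div_left_inj' (by norm_num)]
    exact_mod_cast h
  have hle : ∀ i : Fin n, exchangeDistLeft l u v i ≤ exchangeDistRight l u v i →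
      |exchangeInstance l u v n i - y a| ≤ |exchangeInstance l u v n i - y b| := by
    intro i h
    rw [hda, hdb, div_le_div_iff_of_pos_right (by norm_num)]
    exact_mod_cast h
  have hge : ∀ i : Fin n, exchangeDistRight l u v i ≤ exchangeDistLeft l u v i →
      |exchangeInstance l u v n i - y b| ≤ |exchangeInstance l u v n i - y a| := by
    intro i h
    rw [hda, hdb, div_le_div_iff_of_pos_right (by norm_num)]
    exact_mod_cast h
  exact ⟨hd, hpa, hpb, hle, hge, hda, hdb⟩

set_option maxHeartbeats 1000000 in
/-- The spare places at the left facility can be filled by agents at `0`. -/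
theorem exchangeInstance_socialWelfare_ne_of_le {n l u v : ℕ} {q y : Fin 2 → ℝ} {a b : Fin 2}
    (hab : a ≠ b) (hya : y a = 2 / 10) (hyb : y b = 4 / 10)
    (hu : u + 1 ≤ ⌊q a * n⌋₊) (hv : v + 1 ≤ ⌊q b * n⌋₊)
    (hn : ⌊q a * n⌋₊ + ⌊q b * n⌋₊ < n) (hl : l + u + v < n)
    (hcase : ⌊q a * n⌋₊ ≤ l + u) :
    ∃ s t, IsNash q y (exchangeInstance l u v n) s ∧ IsNash q y (exchangeInstance l u v n) t ∧
      socialWelfare q y (exchangeInstance l u v n) s ≠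
        socialWelfare q y (exchangeInstance l u v n) t := by
  obtain ⟨hd, hpa, hpb, hle, hge, hda, hdb⟩ := exchangeInstance_queue_facts l u v n hab hya hyb
  have hmid : |exchangeInstance l u v n ⟨l + u, by omega⟩ - y a| =
      |exchangeInstance l u v n ⟨l + u, by omega⟩ - y b| := by
    rw [hda, hdb]; simp [exchangeDistLeft, exchangeDistRight]
  -- After the `u` agents at `2/10` and one place reserved for the exchange, `w` places are left for
  -- agents at `0`.
  obtain ⟨w, hw⟩ : ∃ w, w + u + 1 = ⌊q a * n⌋₊ := ⟨⌊q a * n⌋₊ - u - 1, by omega⟩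
  -- The agent at the midpoint `3/10` trades with agent `w`, the first agent at `0` outside `F`.
  -- Agents at `9/10` are farther from `4/10` than those at `0`, so they come last in both queues.
  refine exists_isNash_socialWelfare_ne hab hd
    (F := Finset.univ.filter fun i : Fin n => (i : ℕ) < w ∨ (l ≤ (i : ℕ) ∧ (i : ℕ) < l + u))
    (K := Finset.univ.filter fun i : Fin n => l + u + 1 ≤ (i : ℕ) ∧ (i : ℕ) < l + u + v + 1)
    (a := ⟨l + u, by omega⟩) (e := ⟨w, by omega⟩)
    ?_ ?_ ?_ ?_ ?_ ?_ ?_ ?_ ?_ ?_ hmid ?_ ?_ ?_ ?_ ?_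
  · rw [Ne, Fin.mk.injEq]; omega
  · simp only [Finset.mem_filter, Finset.mem_univ, true_and]; omega
  · simp only [Finset.mem_filter, Finset.mem_univ, true_and]; omega
  · simp only [Finset.mem_filter, Finset.mem_univ, true_and]; omega
  · simp only [Finset.mem_filter, Finset.mem_univ, true_and]; omega
  · rw [Finset.disjoint_left]
    intro i
    simp only [Finset.mem_filter, Finset.mem_univ, true_and]; omega
  · rw [Finset.filter_or, Finset.card_union_of_disjoint, card_filter_val_Ico (by omega),
      Fin.card_filter_val_lt]
    · omega
    · rw [Finset.disjoint_left]
      intro i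
      simp only [Finset.mem_filter, Finset.mem_univ, true_and]; omega
  · rw [card_filter_val_Ico (by omega)]; omega
  · intro i hi
    simp only [Finset.mem_filter, Finset.mem_univ, true_and] at hi
    apply hle; unfold exchangeDistLeft exchangeDistRight; split_ifs <;> omega
  · intro i hi
    simp only [Finset.mem_filter, Finset.mem_univ, true_and] at hi
    apply hge; unfold exchangeDistLeft exchangeDistRight; split_ifs <;> omega
  · have : w < l := by omega
    rw [hda, hdb]; norm_num [exchangeDistLeft, exchangeDistRight, this]
  · intro k hk
    simp only [Finset.mem_filter, Finset.mem_univ, true_and] at hk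
    apply hpa; simp only [exchangeDistLeft]; split_ifs <;> omega
  · apply hpa; simp only [exchangeDistLeft]; split_ifs <;> omega
  · intro i h1 h2 h3 h4
    simp only [Finset.mem_filter, Finset.mem_univ, true_and] at h1 h2
    replace h3 : (i : ℕ) ≠ l + u := fun h => h3 (Fin.ext h)
    replace h4 : (i : ℕ) ≠ w := fun h => h4 (Fin.ext h)
    refine ⟨?_, ?_, fun k hk => ?_⟩
    · apply hpa; simp only [exchangeDistLeft]; split_ifs <;> omega
    · apply hpa; simp only [exchangeDistLeft]; split_ifs <;> omega
    · simp only [Finset.mem_filter, Finset.mem_univ, true_and] at hk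
      apply hpa; simp only [exchangeDistLeft]; split_ifs <;> omega
  · intro i h1 h2 h3 h4
    simp only [Finset.mem_filter, Finset.mem_univ, true_and] at h1 h2
    replace h3 : (i : ℕ) ≠ l + u := fun h => h3 (Fin.ext h)
    replace h4 : (i : ℕ) ≠ w := fun h => h4 (Fin.ext h)
    refine ⟨?_, ?_, fun k hk => ?_⟩
    · apply hpb; simp only [exchangeDistRight]; split_ifs <;> omega
    · apply hpb; simp only [exchangeDistRight]; split_ifs <;> omega
    · simp only [Finset.mem_filter, Finset.mem_univ, true_and] at hk
      apply hpb; simp only [exchangeDistRight]; split_ifs <;> omega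

set_option maxHeartbeats 1000000 in
/-- Agents at `9/10` have to use the spare places at the left facility. -/
theorem exchangeInstance_socialWelfare_ne_of_lt {n l u v : ℕ} {q y : Fin 2 → ℝ} {a b : Fin 2}
    (hab : a ≠ b) (hya : y a = 2 / 10) (hyb : y b = 4 / 10)
    (hv : v + 1 ≤ ⌊q b * n⌋₊)
    (hn : ⌊q a * n⌋₊ + ⌊q b * n⌋₊ < n) (hl : l + u + v < n)
    (hcase : l + u < ⌊q a * n⌋₊) :
    ∃ s t, IsNash q y (exchangeInstance l u v n) s ∧ IsNash q y (exchangeInstance l u v n) t ∧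
      socialWelfare q y (exchangeInstance l u v n) s ≠
        socialWelfare q y (exchangeInstance l u v n) t := by
  obtain ⟨hd, hpa, hpb, hle, hge, hda, hdb⟩ := exchangeInstance_queue_facts l u v n hab hya hyb
  have hmid : |exchangeInstance l u v n ⟨l + u, by omega⟩ - y a| =
      |exchangeInstance l u v n ⟨l + u, by omega⟩ - y b| := by
    rw [hda, hdb]; simp [exchangeDistLeft, exchangeDistRight]
  obtain ⟨c, hc⟩ : ∃ c, c + 1 = ⌊q b * n⌋₊ := ⟨⌊q b * n⌋₊ - 1, by omega⟩
  -- The left facility has room for everybody at `0` and `2/10` and one more, so the roles are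
  -- reversed: `F` consists of the `v` agents at `4/10` and the first ones at `9/10`, and the
  -- midpoint agent trades with the next agent at `9/10`, which exists because the total capacity is
  -- below `n`.
  refine exists_isNash_socialWelfare_ne hab.symm hd
    (F := Finset.univ.filter fun i : Fin n => l + u + 1 ≤ (i : ℕ) ∧ (i : ℕ) < l + u + 1 + c)
    (K := Finset.univ.filter fun i : Fin n => 0 ≤ (i : ℕ) ∧ (i : ℕ) < l + u)
    (a := ⟨l + u, by omega⟩) (e := ⟨l + u + 1 + c, by omega⟩)
    ?_ ?_ ?_ ?_ ?_ ?_ ?_ ?_ ?_ ?_ hmid.symm ?_ ?_ ?_ ?_ ?_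
  · rw [Ne, Fin.mk.injEq]; omega
  · simp only [Finset.mem_filter, Finset.mem_univ, true_and]; omega
  · simp only [Finset.mem_filter, Finset.mem_univ, true_and]; omega
  · simp only [Finset.mem_filter, Finset.mem_univ, true_and]; omega
  · simp only [Finset.mem_filter, Finset.mem_univ, true_and]; omega
  · rw [Finset.disjoint_left]
    intro i
    simp only [Finset.mem_filter, Finset.mem_univ, true_and]; omega
  · rw [card_filter_val_Ico (by omega)]; omega
  · rw [card_filter_val_Ico (by omega)]; omega
  · intro i hi
    simp only [Finset.mem_filter, Finset.mem_univ, true_and] at hi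
    apply hge; unfold exchangeDistLeft exchangeDistRight; split_ifs <;> omega
  · intro i hi
    simp only [Finset.mem_filter, Finset.mem_univ, true_and] at hi
    apply hle; unfold exchangeDistLeft exchangeDistRight; split_ifs <;> omega
  · have h : exchangeDistLeft l u v (l + u + 1 + c) = 7 ∧
        exchangeDistRight l u v (l + u + 1 + c) = 5 := by
      simp only [exchangeDistLeft, exchangeDistRight]; split_ifs <;> omega
    rw [hda, hdb]; norm_num [h.1, h.2]
  · intro k hk
    simp only [Finset.mem_filter, Finset.mem_univ, true_and] at hk
    apply hpb; simp only [exchangeDistRight]; split_ifs <;> omega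
  · apply hpb; simp only [exchangeDistRight]; split_ifs <;> omega
  · intro i h1 h2 h3 h4
    simp only [Finset.mem_filter, Finset.mem_univ, true_and] at h1 h2
    replace h3 : (i : ℕ) ≠ l + u := fun h => h3 (Fin.ext h)
    replace h4 : (i : ℕ) ≠ l + u + 1 + c := fun h => h4 (Fin.ext h)
    refine ⟨?_, ?_, fun k hk => ?_⟩
    · apply hpb; simp only [exchangeDistRight]; split_ifs <;> omega
    · apply hpb; simp only [exchangeDistRight]; split_ifs <;> omega
    · simp only [Finset.mem_filter, Finset.mem_univ, true_and] at hk
      apply hpb; simp only [exchangeDistRight]; split_ifs <;> omega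
  · intro i h1 h2 h3 h4
    simp only [Finset.mem_filter, Finset.mem_univ, true_and] at h1 h2
    replace h3 : (i : ℕ) ≠ l + u := fun h => h3 (Fin.ext h)
    replace h4 : (i : ℕ) ≠ l + u + 1 + c := fun h => h4 (Fin.ext h)
    refine ⟨?_, ?_, fun k hk => ?_⟩
    · apply hpa; simp only [exchangeDistLeft]; split_ifs <;> omega
    · apply hpa; simp only [exchangeDistLeft]; split_ifs <;> omega
    · simp only [Finset.mem_filter, Finset.mem_univ, true_and] at hk
      apply hpa; simp only [exchangeDistLeft]; split_ifs <;> omega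

theorem exchangeInstance_socialWelfare_ne {n l u v : ℕ} {q y : Fin 2 → ℝ} {a b : Fin 2}
    (hab : a ≠ b) (hya : y a = 2 / 10) (hyb : y b = 4 / 10)
    (hu : u + 1 ≤ ⌊q a * n⌋₊) (hv : v + 1 ≤ ⌊q b * n⌋₊)
    (hn : ⌊q a * n⌋₊ + ⌊q b * n⌋₊ < n) (hl : l + u + v < n) :
    ∃ s t, IsNash q y (exchangeInstance l u v n) s ∧ IsNash q y (exchangeInstance l u v n) t ∧
      socialWelfare q y (exchangeInstance l u v n) s ≠
        socialWelfare q y (exchangeInstance l u v n) t := by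
  rcases le_or_gt ⌊q a * n⌋₊ (l + u) with h | h
  · exact exchangeInstance_socialWelfare_ne_of_le hab hya hyb hu hv hn hl h
  · exact exchangeInstance_socialWelfare_ne_of_lt hab hya hyb hv hn hl h

/-- A percentile mechanism with percentiles `p a < p b` and positive capacities can only be
Equilibrium Stable if `p b - p a ≥ q a + q b`. -/
theorem le_percentile_sub_of_isEquilibriumStable {q p : Fin 2 → ℝ} {a b : Fin 2} (hab : a ≠ b)
    (hq : ∀ j, 0 < q j) (hQ : q a + q b < 1) (hp : ∀ j, p j ∈ Set.Icc (0 : ℝ) 1)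
    (hlt : p a < p b)
    (hES : ∀ n : ℕ, IsEquilibriumStable q (percentileMechanism (n := n + 1) p)) :
    q a + q b ≤ p b - p a := by
  by_contra hcon
  push Not at hcon
  -- The constants leave room for the roundings: each floor loses less than one, and the integer
  -- inequalities `h1` to `h4` need a margin of two.
  obtain ⟨N, hN1, hN2, hN3, hN4⟩ : ∃ N : ℕ, 3 ≤ q a * N ∧ 3 ≤ q b * N ∧ 3 ≤ (p b - p a) * N ∧
      6 ≤ (q a + q b - (p b - p a)) * N := by
    have h : ∀ c d : ℝ, 0 < d → ∀ᶠ N : ℕ in atTop, c ≤ d * N := fun c d hd =>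
      (tendsto_natCast_atTop_atTop.const_mul_atTop hd).eventually_ge_atTop c
    exact ((h 3 _ (hq a)).and ((h 3 _ (hq b)).and ((h 3 _ (sub_pos.2 hlt)).and
      (h 6 _ (sub_pos.2 hcon))))).exists
  have hN0 : (0 : ℝ) ≤ N := Nat.cast_nonneg N
  have hcast : ((N + 1 : ℕ) : ℝ) = N + 1 := by push_cast; ring
  have hpa := Nat.floor_le (mul_nonneg (hp a).1 hN0)
  have hpb := Nat.floor_le (mul_nonneg (hp b).1 hN0)
  have hpa' := Nat.lt_floor_add_one (p a * (N : ℝ))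
  have hpb' := Nat.lt_floor_add_one (p b * (N : ℝ))
  have hqa := Nat.floor_le (mul_nonneg (hq a).le (Nat.cast_nonneg (N + 1)))
  have hqb := Nat.floor_le (mul_nonneg (hq b).le (Nat.cast_nonneg (N + 1)))
  have hqa' := Nat.lt_floor_add_one (q a * ((N + 1 : ℕ) : ℝ))
  have hqb' := Nat.lt_floor_add_one (q b * ((N + 1 : ℕ) : ℝ))
  have hqa0 := hq a
  have hqb0 := hq b
  set ia := ⌊p a * (N : ℝ)⌋₊ with hia
  set ib := ⌊p b * (N : ℝ)⌋₊ with hib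
  have hib_le : ib ≤ N := by
    have : (ib : ℝ) ≤ N := by nlinarith [(hp b).2]
    exact_mod_cast this
  have h1 : 2 ≤ ⌊q a * ((N + 1 : ℕ) : ℝ)⌋₊ := by
    apply Nat.le_floor; rw [hcast]; push_cast; nlinarith
  have h2 : 2 ≤ ⌊q b * ((N + 1 : ℕ) : ℝ)⌋₊ := by
    apply Nat.le_floor; rw [hcast]; push_cast; nlinarith
  have h3 : ia + 2 ≤ ib := by
    have : (ia : ℝ) + 1 < ib := by nlinarith
    have : ia + 1 < ib := by exact_mod_cast this
    omega
  have h4 : ib + 2 ≤ ia + ⌊q a * ((N + 1 : ℕ) : ℝ)⌋₊ + ⌊q b * ((N + 1 : ℕ) : ℝ)⌋₊ := by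
    have : (ib : ℝ) + 2 ≤ ia + (⌊q a * ((N + 1 : ℕ) : ℝ)⌋₊ : ℝ) + (⌊q b * ((N + 1 : ℕ) : ℝ)⌋₊ : ℝ) := by
      rw [hcast] at *
      nlinarith
    exact_mod_cast this
  have h5 : ⌊q a * ((N + 1 : ℕ) : ℝ)⌋₊ + ⌊q b * ((N + 1 : ℕ) : ℝ)⌋₊ < N + 1 := by
    have : (⌊q a * ((N + 1 : ℕ) : ℝ)⌋₊ : ℝ) + (⌊q b * ((N + 1 : ℕ) : ℝ)⌋₊ : ℝ) < N + 1 := by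
      rw [hcast] at *
      nlinarith
    exact_mod_cast this
  -- The gap `ib - ia` is split into two positive parts, each leaving a place free at its facility;
  -- `h4` is what makes this possible.
  obtain ⟨u, v, hu, hv, hu1, hv1, huv⟩ : ∃ u v, u + 1 ≤ ⌊q a * ((N + 1 : ℕ) : ℝ)⌋₊ ∧
      v + 1 ≤ ⌊q b * ((N + 1 : ℕ) : ℝ)⌋₊ ∧ 1 ≤ u ∧ 1 ≤ v ∧ ia + u + v = ib := by
    rcases le_total ⌊q a * ((N + 1 : ℕ) : ℝ)⌋₊ (ib - ia) with h | h
    · exact ⟨⌊q a * ((N + 1 : ℕ) : ℝ)⌋₊ - 1, ib - ia - (⌊q a * ((N + 1 : ℕ) : ℝ)⌋₊ - 1),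
        by omega, by omega, by omega, by omega, by omega⟩
    · exact ⟨ib - ia - 1, 1, by omega, by omega, by omega, by omega, by omega⟩
  have hx := monotone_exchangeInstance ia u v (N + 1)
  have hidx : ∀ j, percentileMechanism p (exchangeInstance ia u v (N + 1)) j =
      exchangeInstance ia u v (N + 1) (Fin.ofNat (N + 1) ⌊p j * (N : ℝ)⌋₊) := by
    intro j
    rw [percentileMechanism_of_monotone p hx j, hcast, add_sub_cancel_right]
  -- Index `ia` is the first agent at `2/10`, and index `ib = ia + u + v` is the last one at `4/10`;
  -- both exist because `u` and `v` are positive.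
  have hya : percentileMechanism p (exchangeInstance ia u v (N + 1)) a = 2 / 10 := by
    rw [hidx, ← hia]
    have : ((Fin.ofNat (N + 1) ia : Fin (N + 1)) : ℕ) = ia :=
      Nat.mod_eq_of_lt (by omega)
    unfold exchangeInstance
    rw [this, if_neg (by omega), if_pos (by omega)]
  have hyb : percentileMechanism p (exchangeInstance ia u v (N + 1)) b = 4 / 10 := by
    rw [hidx, ← hib]
    have : ((Fin.ofNat (N + 1) ib : Fin (N + 1)) : ℕ) = ib :=
      Nat.mod_eq_of_lt (by omega)
    unfold exchangeInstance
    rw [this, if_neg (by omega), if_neg (by omega), if_neg (by omega), if_pos (by omega)]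
  obtain ⟨s, t, hs, ht, hne⟩ := exchangeInstance_socialWelfare_ne (l := ia) hab hya hyb hu hv h5
    (by omega)
  exact hne (hES N _ (exchangeInstance_mem_cube ia u v (N + 1)) s t hs ht)

/-! ### Absolutely continuous measures with support `[0, 1]` -/

section Radius

theorem nullSingletonClass_of_absolutelyContinuous {μ : Measure ℝ} (hac : μ ≪ volume) : NullSingletonClass μ :=
  ⟨fun x => hac (by simp)⟩

theorem measure_compl_Icc_eq_zero {μ : Measure ℝ} (hsupp : μ.support = Set.Icc 0 1) :
    μ (Set.Icc (0 : ℝ) 1)ᶜ = 0 := hsupp ▸ Measure.measure_compl_support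

variable {μ : Measure ℝ} [IsProbabilityMeasure μ]

theorem measureReal_Icc_eq_cdf_sub [NullSingletonClass μ] {a b : ℝ} (h : a ≤ b) :
    μ.real (Set.Icc a b) = cdf μ b - cdf μ a := by
  rw [cdf_eq_real, cdf_eq_real, measureReal_congr (Ioc_ae_eq_Icc (μ := μ)).symm,
    ← Set.Iic_sdiff_Iic, measureReal_sdiff (Set.Iic_subset_Iic.2 h) measurableSet_Iic]

theorem continuous_cdf [NullSingletonClass μ] : Continuous (cdf μ) := by
  rw [continuous_iff_continuousAt]
  intro x
  rw [continuousAt_iff_continuous_left'_right']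
  refine ⟨?_, ((cdf μ).right_continuous x).mono Set.Ioi_subset_Ici_self⟩
  rw [(cdf μ).mono.continuousWithinAt_Iio_iff_leftLim_eq]
  have h : (cdf μ).measure {x} = 0 := by rw [measure_cdf]; exact measure_singleton x
  rw [StieltjesFunction.measure_singleton, ENNReal.ofReal_eq_zero] at h
  have := (cdf μ).mono.leftLim_le (le_refl x)
  linarith

theorem cdf_eq_zero_of_nonpos [NullSingletonClass μ] (hsupp : μ.support = Set.Icc 0 1) {a : ℝ} (ha : a ≤ 0) :
    cdf μ a = 0 := by
  have h : μ (Set.Iio (0 : ℝ)) = 0 :=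
    measure_mono_null (fun x hx (hx' : x ∈ Set.Icc (0 : ℝ) 1) => (not_le.2 hx) hx'.1) (measure_compl_Icc_eq_zero hsupp)
  have h' : μ (Set.Iic (0 : ℝ)) = 0 := by rw [← measure_congr (Iio_ae_eq_Iic (μ := μ)), h]
  rw [cdf_eq_real, measureReal_def, measure_mono_null (Set.Iic_subset_Iic.2 ha) h']
  simp

theorem cdf_eq_one_of_one_le (hsupp : μ.support = Set.Icc 0 1) {a : ℝ} (ha : 1 ≤ a) :
    cdf μ a = 1 := by
  have h : μ (Set.Iic a)ᶜ = 0 :=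
    measure_mono_null (fun x hx (hx' : x ∈ Set.Icc (0 : ℝ) 1) => hx (hx'.2.trans ha)) (measure_compl_Icc_eq_zero hsupp)
  rw [cdf_eq_real, measureReal_def, (prob_compl_eq_zero_iff measurableSet_Iic).1 h]
  simp

/-- The interval from `a` to `b` contains an interior point of its own lying in the support, hence
has positive mass. -/
theorem cdf_lt_cdf [NullSingletonClass μ] (hsupp : μ.support = Set.Icc 0 1) {a b : ℝ} (hab : a < b)
    (ha : a < 1) (hb : 0 < b) : cdf μ a < cdf μ b := by
  obtain ⟨c, hc1, hc2⟩ := exists_between (max_lt (lt_min hab ha) (lt_min hb one_pos))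
  rw [max_lt_iff] at hc1
  rw [lt_min_iff] at hc2
  have hc : c ∈ μ.support := hsupp ▸ ⟨hc1.2.le, hc2.2.le⟩
  have hpos : 0 < μ (Set.Icc a b) :=
    (Measure.mem_support_iff_forall c).1 hc _ (Icc_mem_nhds hc1.1 hc2.1)
  have := ENNReal.toReal_pos hpos.ne' (measure_ne_top _ _)
  rw [← measureReal_def, measureReal_Icc_eq_cdf_sub hab.le] at this
  linarith

/-- The one-facility radius equation has exactly one solution. -/
theorem existsUnique_isRadius [NullSingletonClass μ] (hsupp : μ.support = Set.Icc 0 1) {q y : ℝ} (hq : 0 ≤ q)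
    (hq1 : q < 1) (hy : y ∈ Set.Icc (0 : ℝ) 1) : ∃! r, IsRadius μ q y r := by
  have hcdf : ∀ r, 0 ≤ r → μ.real (Set.Icc (y - r) (y + r)) = cdf μ (y + r) - cdf μ (y - r) :=
    fun r hr => measureReal_Icc_eq_cdf_sub (by linarith)
  -- Enlarging the ball adds mass unless it already covers `[0, 1]`, and then its mass is `1 > q`.
  have hlt : ∀ r r', 0 ≤ r → r < r' → IsRadius μ q y r → IsRadius μ q y r' → False := by
    intro r r' hr hrr h h'
    have e := h.2
    have e' := h'.2
    rw [hcdf r hr] at e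
    rw [hcdf r' (hr.trans hrr.le)] at e'
    have m1 := monotone_cdf μ (show y + r ≤ y + r' by linarith)
    have m2 := monotone_cdf μ (show y - r' ≤ y - r by linarith)
    have h1 : 1 ≤ y + r := by
      by_contra hc
      have := cdf_lt_cdf hsupp (show y + r < y + r' by linarith) (not_le.1 hc) (by linarith [hy.1])
      linarith
    have h2 : y - r ≤ 0 := by
      by_contra hc
      have := cdf_lt_cdf hsupp (show y - r' < y - r by linarith) (by linarith [hy.2]) (not_le.1 hc)
      linarith
    rw [cdf_eq_one_of_one_le hsupp h1, cdf_eq_zero_of_nonpos hsupp h2] at e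
    linarith
  obtain ⟨r, hr, hre⟩ : ∃ r ∈ Set.Icc (0 : ℝ) 1, cdf μ (y + r) - cdf μ (y - r) = q := by
    have hcont : ContinuousOn (fun r => cdf μ (y + r) - cdf μ (y - r)) (Set.Icc 0 1) :=
      ((continuous_cdf.comp (continuous_const.add continuous_id)).sub
        (continuous_cdf.comp (continuous_const.sub continuous_id))).continuousOn
    apply intermediate_value_Icc zero_le_one hcont
    simp only [add_zero, sub_zero, sub_self]
    rw [cdf_eq_one_of_one_le hsupp (by linarith [hy.1]),
      cdf_eq_zero_of_nonpos hsupp (by linarith [hy.2])]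
    exact ⟨hq, by linarith⟩
  have hr' : IsRadius μ q y r := ⟨hr.1, by rw [hcdf r hr.1, hre]⟩
  refine ⟨r, hr', fun r' h' => ?_⟩
  rcases lt_trichotomy r' r with h | h | h
  · exact (hlt r' r h'.1 h h' hr').elim
  · exact h
  · exact (hlt r r' hr.1 h hr' h').elim

theorem isRadius_iff_eq_radius [NullSingletonClass μ] (hsupp : μ.support = Set.Icc 0 1) {q y : ℝ}
    (hq : 0 ≤ q) (hq1 : q < 1) (hy : y ∈ Set.Icc (0 : ℝ) 1) (r : ℝ) :
    IsRadius μ q y r ↔ r = radius μ q y := by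
  obtain ⟨r₀, h₀, huniq⟩ := existsUnique_isRadius hsupp hq hq1 hy
  have hset : {r | IsRadius μ q y r} = {r₀} := by
    ext r; exact ⟨fun h => huniq r h, fun h => by rw [Set.mem_singleton_iff.1 h]; exact h₀⟩
  have : radius μ q y = r₀ := by rw [radius, hset, csInf_singleton]
  rw [this]
  exact ⟨fun h => huniq r h, fun h => h ▸ h₀⟩

/-- Balls of masses `q₁`, `q₂` around points whose distribution function values are at least
`q₁ + q₂` apart do not overlap. -/
theorem add_radius_le_sub_radius [NullSingletonClass μ] (hsupp : μ.support = Set.Icc 0 1)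
    {q₁ q₂ y₁ y₂ r₁ r₂ : ℝ} (hQ : q₁ + q₂ < 1) (hq₁ : 0 ≤ q₁)
    (hy₁ : y₁ ∈ Set.Icc (0 : ℝ) 1) (hy₂ : y₂ ∈ Set.Icc (0 : ℝ) 1) (hle : y₁ ≤ y₂)
    (hF : q₁ + q₂ ≤ cdf μ y₂ - cdf μ y₁)
    (h₁ : IsRadius μ q₁ y₁ r₁) (h₂ : IsRadius μ q₂ y₂ r₂) : y₁ + r₁ ≤ y₂ - r₂ := by
  by_contra hc
  push Not at hc
  obtain ⟨hr₁, e₁⟩ := h₁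
  obtain ⟨hr₂, e₂⟩ := h₂
  rw [measureReal_Icc_eq_cdf_sub (by linarith)] at e₁ e₂
  -- Adding `e₁` and `e₂` gives `q₁ + q₂ ≥ F (y₂ + r₂) - F (y₁ - r₁) ≥ F y₂ - F y₁ ≥ q₁ + q₂`.
  have m1 := monotone_cdf μ (show y₁ - r₁ ≤ y₁ by linarith)
  have m2 := monotone_cdf μ (show y₂ ≤ y₂ + r₂ by linarith)
  have m3 := monotone_cdf μ hc.le
  -- all of these are equalities
  have h1 : y₁ ≤ 0 ∨ r₁ = 0 := by
    by_contra h; push Not at h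
    have := cdf_lt_cdf hsupp (show y₁ - r₁ < y₁ by linarith [hr₁.lt_of_ne' h.2])
      (by linarith [hr₁.lt_of_ne' h.2, hy₁.2]) h.1
    linarith
  have h2 : 1 ≤ y₂ ∨ r₂ = 0 := by
    by_contra h; push Not at h
    have := cdf_lt_cdf hsupp (show y₂ < y₂ + r₂ by linarith [hr₂.lt_of_ne' h.2])
      h.1 (by linarith [hr₂.lt_of_ne' h.2, hy₂.1])
    linarith
  have h3 : 1 ≤ y₂ - r₂ ∨ y₁ + r₁ ≤ 0 := by
    by_contra h; push Not at h
    have := cdf_lt_cdf hsupp hc h.1 h.2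
    linarith
  -- In the remaining positions either one ball covers `[0, 1]` and has mass `1`, or a zero radius
  -- contradicts the overlap `hc`.
  rcases h3 with h3 | h3
  · have hr : r₂ = 0 := by linarith [hy₂.2]
    have hy : y₂ = 1 := by linarith [hy₂.2]
    have hF1 : cdf μ y₂ = 1 := cdf_eq_one_of_one_le hsupp hy.ge
    rcases h1 with h1 | h1
    · rw [cdf_eq_zero_of_nonpos hsupp h1] at hF m1
      have := cdf_eq_one_of_one_le hsupp (show (1 : ℝ) ≤ y₁ + r₁ by linarith)
      have := cdf_nonneg μ (y₁ - r₁)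
      linarith
    · linarith
  · have hr : r₁ = 0 := by linarith [hy₁.1]
    have hy : y₁ = 0 := by linarith [hy₁.1]
    rcases h2 with h2 | h2
    · have h4 := cdf_eq_one_of_one_le hsupp (show (1 : ℝ) ≤ y₂ + r₂ by linarith)
      have h5 := cdf_eq_zero_of_nonpos hsupp (show y₂ - r₂ ≤ 0 by linarith)
      linarith
    · linarith

theorem isOrderedTwoRadius_radius [NullSingletonClass μ] (hsupp : μ.support = Set.Icc 0 1)
    {q₁ q₂ y₁ y₂ r₁ r₂ : ℝ} (hQ : q₁ + q₂ < 1) (hq₁ : 0 ≤ q₁)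
    (hy₁ : y₁ ∈ Set.Icc (0 : ℝ) 1) (hy₂ : y₂ ∈ Set.Icc (0 : ℝ) 1) (hle : y₁ ≤ y₂)
    (hF : q₁ + q₂ ≤ cdf μ y₂ - cdf μ y₁)
    (h₁ : IsRadius μ q₁ y₁ r₁) (h₂ : IsRadius μ q₂ y₂ r₂) :
    IsOrderedTwoRadius μ q₁ q₂ y₁ y₂ r₁ r₂ := by
  have h := add_radius_le_sub_radius hsupp hQ hq₁ hy₁ hy₂ hle hF h₁ h₂
  refine ⟨h₁.1, h₂.1, ?_, ?_⟩
  · rw [min_eq_right (h.trans (le_max_right _ _))]; exact h₁.2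
  · rw [max_eq_right ((min_le_left _ _).trans h)]; exact h₂.2

/-- Without overlap the system decouples. With overlap the intervals are adjacent, so `q₁ + q₂ = F
(y₂ + r₂) - F (y₁ - r₁)`; comparison with `hF` forces `y₁ = 0` and `y₂ = 1`, hence total mass `1`.
-/
theorem isRadius_of_isOrderedTwoRadius [NullSingletonClass μ] (hsupp : μ.support = Set.Icc 0 1)
    {q₁ q₂ y₁ y₂ r₁ r₂ : ℝ} (hQ : q₁ + q₂ < 1) (hq₁ : 0 < q₁) (hq₂ : 0 < q₂)
    (hy₁ : y₁ ∈ Set.Icc (0 : ℝ) 1) (hy₂ : y₂ ∈ Set.Icc (0 : ℝ) 1)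
    (hF : q₁ + q₂ ≤ cdf μ y₂ - cdf μ y₁)
    (h : IsOrderedTwoRadius μ q₁ q₂ y₁ y₂ r₁ r₂) :
    IsRadius μ q₁ y₁ r₁ ∧ IsRadius μ q₂ y₂ r₂ := by
  obtain ⟨hr₁, hr₂, e₁, e₂⟩ := h
  rcases le_or_gt (y₁ + r₁) (y₂ - r₂) with hle | hgt
  · rw [min_eq_right (hle.trans (le_max_right _ _))] at e₁
    rw [max_eq_right ((min_le_left _ _).trans hle)] at e₂
    exact ⟨⟨hr₁, e₁⟩, ⟨hr₂, e₂⟩⟩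
  · exfalso
    -- the two intervals meet at a common end point
    have hc : min (max ((y₁ + y₂) / 2) (y₂ - r₂)) (y₁ + r₁) =
        max (min (y₁ + r₁) ((y₁ + y₂) / 2)) (y₂ - r₂) := by
      rw [min_comm (y₁ + r₁), max_min_distrib_right, max_eq_left hgt.le]
    rw [← hc] at e₂
    set c := min (max ((y₁ + y₂) / 2) (y₂ - r₂)) (y₁ + r₁)
    have hc1 : y₁ - r₁ ≤ c := by
      by_contra hn
      rw [Set.Icc_eq_empty hn] at e₁; simp at e₁; linarith
    have hc2 : c ≤ y₂ + r₂ := by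
      by_contra hn
      rw [Set.Icc_eq_empty hn] at e₂; simp at e₂; linarith
    rw [measureReal_Icc_eq_cdf_sub hc1] at e₁
    rw [measureReal_Icc_eq_cdf_sub hc2] at e₂
    -- Here positivity of the capacities enters: a zero radius would leave its facility an interval
    -- without mass.
    have hr₁' : r₁ ≠ 0 := by
      rintro rfl
      have := monotone_cdf μ (show c ≤ y₁ - 0 from (min_le_right _ _).trans (by linarith))
      linarith
    have hr₂' : r₂ ≠ 0 := by
      rintro rfl
      have := monotone_cdf μ (show y₂ + 0 ≤ c by
        rw [hc]; exact le_trans (by linarith) (le_max_right _ _))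
      linarith
    have m1 := monotone_cdf μ (show y₁ - r₁ ≤ y₁ by linarith)
    have m2 := monotone_cdf μ (show y₂ ≤ y₂ + r₂ by linarith)
    have hy1 : y₁ ≤ 0 := by
      by_contra hn
      have := cdf_lt_cdf hsupp (show y₁ - r₁ < y₁ by linarith [hr₁.lt_of_ne' hr₁'])
        (by linarith [hr₁.lt_of_ne' hr₁', hy₁.2]) (not_le.1 hn)
      linarith
    have hy2 : 1 ≤ y₂ := by
      by_contra hn
      have := cdf_lt_cdf hsupp (show y₂ < y₂ + r₂ by linarith [hr₂.lt_of_ne' hr₂'])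
        (not_le.1 hn) (by linarith [hr₂.lt_of_ne' hr₂', hy₂.1])
      linarith
    rw [cdf_eq_zero_of_nonpos hsupp hy1, cdf_eq_one_of_one_le hsupp hy2] at *
    have := cdf_eq_zero_of_nonpos hsupp (show y₁ - r₁ ≤ 0 by linarith)
    have := cdf_eq_one_of_one_le hsupp (show 1 ≤ y₂ + r₂ by linarith)
    linarith

theorem le_of_cdf_sub_nonneg [NullSingletonClass μ] (hsupp : μ.support = Set.Icc 0 1) {y₁ y₂ : ℝ}
    (hy₁ : y₁ ∈ Set.Icc (0 : ℝ) 1) (hy₂ : y₂ ∈ Set.Icc (0 : ℝ) 1)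
    (hF : 0 ≤ cdf μ y₂ - cdf μ y₁) : y₁ ≤ y₂ := by
  by_contra hn
  have := cdf_lt_cdf hsupp (not_le.1 hn) (by linarith [hy₁.2]) (by linarith [hy₂.1])
  linarith

end Radius

/-! ### Quantiles -/

section Quantile

theorem cdf_lt_of_lt_quantile {μ : Measure ℝ} {p t : ℝ} (ht : t ∈ Set.Icc (0 : ℝ) 1) (h : t < quantile μ p) :
    cdf μ t < p := by
  by_contra hn
  exact absurd (csInf_le ⟨0, fun x hx => hx.1.1⟩ (show t ∈ {x | x ∈ Set.Icc (0 : ℝ) 1 ∧ p ≤ cdf μ x}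
    from ⟨ht, not_lt.1 hn⟩)) (not_le.2 h)

variable {μ : Measure ℝ} [IsProbabilityMeasure μ]

theorem quantile_mem_Icc (hsupp : μ.support = Set.Icc 0 1) {p : ℝ} (hp : p ≤ 1) :
    quantile μ p ∈ Set.Icc (0 : ℝ) 1 := by
  have h1 : (1 : ℝ) ∈ {x | x ∈ Set.Icc (0 : ℝ) 1 ∧ p ≤ cdf μ x} :=
    ⟨⟨zero_le_one, le_rfl⟩, by rw [cdf_eq_one_of_one_le hsupp le_rfl]; exact hp⟩
  exact ⟨le_csInf ⟨1, h1⟩ fun x hx => hx.1.1, csInf_le ⟨0, fun x hx => hx.1.1⟩ h1⟩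

/-- Strictness comes from full support. The bound `t < 1` is needed for `p = 1`, since `F` is
constant beyond `1`. -/
theorem lt_cdf_of_quantile_lt [NullSingletonClass μ] (hsupp : μ.support = Set.Icc 0 1) {p t : ℝ} (hp : p ≤ 1)
    (ht : t < 1) (h : quantile μ p < t) : p < cdf μ t := by
  have h1 : (1 : ℝ) ∈ {x | x ∈ Set.Icc (0 : ℝ) 1 ∧ p ≤ cdf μ x} :=
    ⟨⟨zero_le_one, le_rfl⟩, by rw [cdf_eq_one_of_one_le hsupp le_rfl]; exact hp⟩
  obtain ⟨x, hx, hxt⟩ := exists_lt_of_csInf_lt ⟨1, h1⟩ h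
  exact hx.2.trans_lt (cdf_lt_cdf hsupp hxt (hxt.trans ht) (hx.1.1.trans_lt hxt))

end Quantile

/-! ### The output of the percentile mechanism -/

section Percentile

variable {m n : ℕ} {p : Fin m → ℝ} {j : Fin m}

theorem floor_percentile_le (hp : p j ≤ 1) : ⌊p j * (n : ℝ)⌋₊ ≤ n := by
  apply Nat.floor_le_of_le
  nlinarith [Nat.cast_nonneg (α := ℝ) n]

/-- The rank used by the percentile mechanism, as an index. -/
theorem percentileMechanism_eq (hp : p j ≤ 1) (x : Fin (n + 1) → ℝ) :
    percentileMechanism p x j =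
      x (Tuple.sort x ⟨⌊p j * (n : ℝ)⌋₊, Nat.lt_succ_of_le (floor_percentile_le hp)⟩) := by
  unfold percentileMechanism
  congr 2
  ext
  rw [Nat.cast_add_one, add_sub_cancel_right]
  exact Nat.mod_eq_of_lt (Nat.lt_succ_of_le (floor_percentile_le hp))

/-- Turns an order statistic into a count of agents, the form needed for measurability and for the
law of large numbers. -/
theorem percentileMechanism_le_iff (hp : p j ≤ 1) (x : Fin (n + 1) → ℝ) (t : ℝ) :
    percentileMechanism p x j ≤ t ↔
      ⌊p j * (n : ℝ)⌋₊ < (Finset.univ.filter fun i => x i ≤ t).card := by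
  have h := Tuple.lt_card_le_iff_apply_le_of_monotone (f := x ∘ Tuple.sort x) (a := t)
    (j := ⟨⌊p j * (n : ℝ)⌋₊, Nat.lt_succ_of_le (floor_percentile_le hp)⟩) (Tuple.monotone_sort x)
  rw [percentileMechanism_eq hp]
  refine h.symm.trans ?_
  have : (Finset.univ.filter fun i => (x ∘ Tuple.sort x) i ≤ t).card =
      (Finset.univ.filter fun i => x i ≤ t).card := by
    refine Finset.card_bij (fun i _ => Tuple.sort x i) ?_
      (fun a _ b _ h => (Tuple.sort x).injective h) ?_
    · intro i hi; simpa using hi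
    · intro i hi
      exact ⟨(Tuple.sort x).symm i, by simpa using hi, by simp⟩
  rw [this]

theorem measurable_percentileMechanism (hp : p j ≤ 1) :
    Measurable fun x : Fin (n + 1) → ℝ => percentileMechanism p x j := by
  refine measurable_of_Iic fun t => ?_
  have : (fun x : Fin (n + 1) → ℝ => percentileMechanism p x j) ⁻¹' Set.Iic t =
      {x | ⌊p j * (n : ℝ)⌋₊ < ∑ i, if x i ≤ t then 1 else 0} := by
    ext x
    rw [Set.mem_preimage, Set.mem_Iic, percentileMechanism_le_iff hp, Finset.card_filter]
    rfl
  rw [this]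
  refine measurableSet_lt measurable_const (Finset.measurable_sum _ fun i _ => ?_)
  exact Measurable.ite (measurableSet_le (measurable_pi_apply i) measurable_const)
    measurable_const measurable_const

theorem exists_percentileMechanism_eq (p : Fin m → ℝ) (x : Fin (n + 1) → ℝ) (j : Fin m) :
    ∃ i, percentileMechanism p x j = x i := ⟨_, rfl⟩

/-- The number of agents between two facilities. -/
theorem le_card_between_percentiles {a b : Fin m} (ha : p a ≤ 1) (hb : p b ≤ 1)
    (x : Fin (n + 1) → ℝ) :
    ⌊p b * (n : ℝ)⌋₊ + 1 ≤ ⌊p a * (n : ℝ)⌋₊ + (Finset.univ.filter fun k =>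
      percentileMechanism p x a ≤ x k ∧ x k ≤ percentileMechanism p x b).card := by
  have hsub : (Finset.Icc (⟨⌊p a * (n : ℝ)⌋₊, Nat.lt_succ_of_le (floor_percentile_le ha)⟩ :
      Fin (n + 1)) ⟨⌊p b * (n : ℝ)⌋₊, Nat.lt_succ_of_le (floor_percentile_le hb)⟩).map
      (Tuple.sort x).toEmbedding ⊆ Finset.univ.filter fun k =>
      percentileMechanism p x a ≤ x k ∧ x k ≤ percentileMechanism p x b := by
    intro k hk
    rw [Finset.mem_map] at hk
    obtain ⟨i, hi, rfl⟩ := hk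
    rw [Finset.mem_Icc] at hi
    rw [Finset.mem_filter, percentileMechanism_eq ha, percentileMechanism_eq hb]
    exact ⟨Finset.mem_univ _, Tuple.monotone_sort x hi.1, Tuple.monotone_sort x hi.2⟩
  have h := Finset.card_le_card hsub
  rw [Finset.card_map, Fin.card_Icc] at h
  simp only at h
  omega

end Percentile

/-! ### Disjointness of the groups of closest agents, and measurability of the split utility -/

/-- With enough agents at distinct positions between the facilities, no agent is among the closest
agents of both. -/
theorem not_fullRank_lt_of_card_between {n : ℕ} {y : Fin 2 → ℝ} {x : Fin n → ℝ} {a b : Fin 2}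
    {ca cb : ℕ} (hx : Function.Injective x)
    (hcard : ca + cb ≤ (Finset.univ.filter fun k => y a ≤ x k ∧ x k ≤ y b).card) (i : Fin n)
    (ha : fullRank y x a i < ca) : ¬ fullRank y x b i < cb := by
  intro hb
  -- An agent between the facilities and left of `i` beats `i` at `a`, one to the right beats it at
  -- `b`. If `i` were among the closest of both, at most `1 + (ca - 1) + (cb - 1)` agents could lie
  -- between.
  have hsub : (Finset.univ.filter fun k => y a ≤ x k ∧ x k ≤ y b) ⊆
      insert i ((Finset.univ.filter fun k => Precedes y x a k i) ∪
        (Finset.univ.filter fun k => Precedes y x b k i)) := by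
    intro k hk
    simp only [Finset.mem_filter, Finset.mem_univ, true_and] at hk
    simp only [Finset.mem_insert, Finset.mem_union, Finset.mem_filter, Finset.mem_univ, true_and]
    rcases lt_trichotomy (x k) (x i) with h | h | h
    · right; left; left
      rw [abs_of_nonneg (by linarith)]
      exact lt_of_lt_of_le (by linarith) (le_abs_self _)
    · exact Or.inl (hx h)
    · right; right; left
      rw [abs_of_nonpos (by linarith)]
      exact lt_of_lt_of_le (by linarith) (neg_le_abs _)
  have h := (Finset.card_le_card hsub).trans (Finset.card_insert_le _ _)
  have h' := Finset.card_union_le (Finset.univ.filter fun k => Precedes y x a k i)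
    (Finset.univ.filter fun k => Precedes y x b k i)
  unfold fullRank at ha hb
  omega

theorem not_fullRank_lt_percentileMechanism {n : ℕ} {p q : Fin 2 → ℝ} {a b : Fin 2}
    (hp : ∀ j, p j ∈ Set.Icc (0 : ℝ) 1) (hq : ∀ j, 0 ≤ q j) (hQ : q a + q b < 1)
    (hpq : q a + q b ≤ p b - p a) {x : Fin (n + 1) → ℝ} (hx : Function.Injective x)
    (i : Fin (n + 1))
    (ha : fullRank (percentileMechanism p x) x a i < ⌊q a * (n + 1 : ℕ)⌋₊) :
    ¬ fullRank (percentileMechanism p x) x b i < ⌊q b * (n + 1 : ℕ)⌋₊ := by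
  refine not_fullRank_lt_of_card_between hx ?_ i ha
  have h := le_card_between_percentiles (hp a).2 (hp b).2 x
  have hn : (0 : ℝ) ≤ n := Nat.cast_nonneg n
  have h1 := Nat.floor_le (mul_nonneg (hp a).1 hn)
  have h2 := Nat.lt_floor_add_one (p b * (n : ℝ))
  have h3 := Nat.floor_le (mul_nonneg (hq a) (Nat.cast_nonneg (n + 1)))
  have h4 := Nat.floor_le (mul_nonneg (hq b) (Nat.cast_nonneg (n + 1)))
  -- The capacities add up to at most `(q a + q b) * (n + 1) < (p b - p a) * n + 1`, using `hQ` for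
  -- the extra agent.
  have h5 : ⌊q a * ((n + 1 : ℕ) : ℝ)⌋₊ + ⌊q b * ((n + 1 : ℕ) : ℝ)⌋₊ + ⌊p a * (n : ℝ)⌋₊ <
      ⌊p b * (n : ℝ)⌋₊ + 2 := by
    have : (⌊q a * ((n + 1 : ℕ) : ℝ)⌋₊ : ℝ) + (⌊q b * ((n + 1 : ℕ) : ℝ)⌋₊ : ℝ) +
        (⌊p a * (n : ℝ)⌋₊ : ℝ) < (⌊p b * (n : ℝ)⌋₊ : ℝ) + 2 := by
      have hcast : ((n + 1 : ℕ) : ℝ) = n + 1 := by push_cast; ring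
      rw [hcast] at h3 h4 ⊢
      nlinarith
    exact_mod_cast this
  omega

theorem measurable_splitUtility {m n : ℕ} {p q : Fin m → ℝ} {j : Fin m} (hp : p j ≤ 1)
    (i : Fin (n + 1)) :
    Measurable fun x : Fin (n + 1) → ℝ => splitUtility q (percentileMechanism p x) x j i := by
  have hdist : ∀ k, Measurable fun x : Fin (n + 1) → ℝ => |x k - percentileMechanism p x j| :=
    fun k => ((measurable_pi_apply k).sub (measurable_percentileMechanism hp)).abs
  have hrank : Measurable fun x : Fin (n + 1) → ℝ => fullRank (percentileMechanism p x) x j i := by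
    simp only [fullRank, Finset.card_filter]
    refine Finset.measurable_sum _ fun k _ => Measurable.ite ?_ measurable_const measurable_const
    exact (measurableSet_lt (hdist k) (hdist i)).union
      ((measurableSet_eq_fun (hdist k) (hdist i)).inter (MeasurableSet.const _))
  exact Measurable.ite (measurableSet_lt hrank measurable_const)
    (measurable_const.sub (hdist i)) measurable_const

/-! ### Comparing the served agents with a ball -/

/-- The closest agents and the agents in the ball are both initial segments of the order by
distance, so one set contains the other. Each agent in the difference contributes a value in `[0,
1]`, so the sums differ by at most the difference of the cardinalities. -/
theorem abs_sum_splitUtility_sub_ball_le {m n : ℕ} (q y : Fin m → ℝ) (x : Fin n → ℝ) (j : Fin m)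
    (hd : ∀ i, |x i - y j| ≤ 1) (hc : ⌊q j * n⌋₊ ≤ n) (R : ℝ) :
    |∑ i, splitUtility q y x j i - ∑ i, (if |x i - y j| ≤ R then 1 - |x i - y j| else 0)| ≤
      |(⌊q j * n⌋₊ : ℝ) - ∑ i, (if |x i - y j| ≤ R then (1 : ℝ) else 0)| := by
  have hcard : (⌊q j * n⌋₊ : ℝ) = ∑ i, (if fullRank y x j i < ⌊q j * n⌋₊ then (1 : ℝ) else 0) := by
    rw [← Finset.sum_filter, Finset.sum_const, card_fullRank_lt, min_eq_left hc]
    simp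
  have hd0 : ∀ i, 0 ≤ |x i - y j| := fun i => abs_nonneg _
  by_cases hsub : ∀ i, fullRank y x j i < ⌊q j * n⌋₊ → |x i - y j| ≤ R
  · rw [abs_sub_comm, abs_sub_comm (⌊q j * n⌋₊ : ℝ)]
    refine le_trans ?_ (le_abs_self _)
    rw [abs_of_nonneg, hcard, ← Finset.sum_sub_distrib, ← Finset.sum_sub_distrib]
    · refine Finset.sum_le_sum fun i _ => ?_
      have := hsub i; have := hd i; have := hd0 i
      unfold splitUtility
      split_ifs <;> first | linarith | (exfalso; tauto)
    · rw [← Finset.sum_sub_distrib]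
      refine Finset.sum_nonneg fun i _ => ?_
      have := hsub i; have := hd i; have := hd0 i
      unfold splitUtility
      split_ifs <;> first | linarith | (exfalso; tauto)
  · push Not at hsub
    obtain ⟨k, hk, hkR⟩ := hsub
    have hsub' : ∀ i, |x i - y j| ≤ R → fullRank y x j i < ⌊q j * n⌋₊ := fun i hi =>
      (fullRank_lt_of_precedes (Or.inl (hi.trans_lt hkR))).trans hk
    refine le_trans ?_ (le_abs_self _)
    rw [abs_of_nonneg, hcard, ← Finset.sum_sub_distrib, ← Finset.sum_sub_distrib]
    · refine Finset.sum_le_sum fun i _ => ?_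
      have := hsub' i; have := hd i; have := hd0 i
      unfold splitUtility
      split_ifs <;> first | linarith | (exfalso; tauto)
    · rw [← Finset.sum_sub_distrib]
      refine Finset.sum_nonneg fun i _ => ?_
      have := hsub' i; have := hd i; have := hd0 i
      unfold splitUtility
      split_ifs <;> first | linarith | (exfalso; tauto)

/-- Counts the end points of `[z - R, z + R]` that are within `δ` of `x`. -/
def boundaryCount (z R δ x : ℝ) : ℝ :=
  (if |x - (z - R)| ≤ δ then 1 else 0) + (if |x - (z + R)| ≤ δ then 1 else 0)

theorem boundaryCount_nonneg (z R δ x : ℝ) : 0 ≤ boundaryCount z R δ x := by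
  unfold boundaryCount; split_ifs <;> norm_num

theorem one_le_boundaryCount {z R δ x : ℝ} (h : |(|x - z|) - R| ≤ δ) :
    1 ≤ boundaryCount z R δ x := by
  unfold boundaryCount
  rcases le_total 0 (x - z) with h0 | h0
  · rw [abs_of_nonneg h0, sub_sub] at h
    rw [if_pos h]
    split_ifs <;> norm_num
  · rw [abs_of_nonpos h0, abs_sub_comm] at h
    have : |x - (z - R)| ≤ δ := by convert h using 2; ring
    rw [if_pos this]
    split_ifs <;> norm_num

/-- Moving the centre by at most `δ` changes membership only for points within `δ` of an end point
of the ball. -/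
theorem abs_ball_indicator_sub_le {x w z R δ : ℝ} (hwz : |w - z| ≤ δ) :
    |(if |x - w| ≤ R then (1 : ℝ) else 0) - (if |x - z| ≤ R then (1 : ℝ) else 0)| ≤
      boundaryCount z R δ x := by
  have h1 : |(|x - w|) - (|x - z|)| ≤ δ :=
    (abs_abs_sub_abs_le _ _).trans (by rw [sub_sub_sub_cancel_left, abs_sub_comm]; exact hwz)
  rw [abs_le] at h1
  have h0 := boundaryCount_nonneg z R δ x
  split_ifs with h2 h3 h3
  · simpa using h0
  · have := one_le_boundaryCount (z := z) (R := R) (δ := δ) (x := x)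
      (by rw [abs_le]; constructor <;> linarith)
    simpa using this
  · have := one_le_boundaryCount (z := z) (R := R) (δ := δ) (x := x)
      (by rw [abs_le]; constructor <;> linarith)
    simpa using this
  · simpa using h0

theorem abs_ball_welfare_sub_le {x w z R δ : ℝ} (hwz : |w - z| ≤ δ) (hw : |x - w| ≤ 1)
    (hz : |x - z| ≤ 1) :
    |(if |x - w| ≤ R then 1 - |x - w| else 0) - (if |x - z| ≤ R then 1 - |x - z| else 0)| ≤
      boundaryCount z R δ x + δ := by
  have h1 : |(|x - w|) - (|x - z|)| ≤ δ :=
    (abs_abs_sub_abs_le _ _).trans (by rw [sub_sub_sub_cancel_left, abs_sub_comm]; exact hwz)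
  have hδ : 0 ≤ δ := (abs_nonneg _).trans hwz
  rw [abs_le] at h1
  have h0 := boundaryCount_nonneg z R δ x
  have hw0 := abs_nonneg (x - w)
  have hz0 := abs_nonneg (x - z)
  split_ifs with h2 h3 h3
  · rw [abs_le]; constructor <;> linarith
  · have := one_le_boundaryCount (z := z) (R := R) (δ := δ) (x := x)
      (by rw [abs_le]; constructor <;> linarith)
    rw [abs_le]; constructor <;> linarith
  · have := one_le_boundaryCount (z := z) (R := R) (δ := δ) (x := x)
      (by rw [abs_le]; constructor <;> linarith)
    rw [abs_le]; constructor <;> linarith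
  · rw [abs_le]; constructor <;> linarith

/-- The welfare that facility `j` generates compared with the welfare inside a ball around a nearby
centre. -/
theorem abs_sum_splitUtility_sub_le {m n : ℕ} (q y : Fin m → ℝ) (x : Fin n → ℝ) (j : Fin m)
    (hd : ∀ i, |x i - y j| ≤ 1) (hc : ⌊q j * n⌋₊ ≤ n) {z δ : ℝ} (R : ℝ)
    (hz : ∀ i, |x i - z| ≤ 1) (hyz : |y j - z| ≤ δ) :
    |∑ i, splitUtility q y x j i - ∑ i, (if |x i - z| ≤ R then 1 - |x i - z| else 0)| ≤
      |(⌊q j * n⌋₊ : ℝ) - ∑ i, (if |x i - z| ≤ R then (1 : ℝ) else 0)| +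
        (2 * ∑ i, boundaryCount z R δ (x i) + n * δ) := by
  -- The centre is moved twice, once in the welfare and once in the count, whence the factor `2` of
  -- the boundary term.
  have h1 := abs_sum_splitUtility_sub_ball_le q y x j hd hc R
  have h2 : |∑ i, (if |x i - y j| ≤ R then 1 - |x i - y j| else 0) -
      ∑ i, (if |x i - z| ≤ R then 1 - |x i - z| else 0)| ≤
      ∑ i, boundaryCount z R δ (x i) + n * δ := by
    rw [← Finset.sum_sub_distrib]
    refine (Finset.abs_sum_le_sum_abs _ _).trans ?_
    refine (Finset.sum_le_sum fun i _ => abs_ball_welfare_sub_le hyz (hd i) (hz i)).trans ?_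
    rw [Finset.sum_add_distrib]; simp
  have h3 : |∑ i, (if |x i - y j| ≤ R then (1 : ℝ) else 0) -
      ∑ i, (if |x i - z| ≤ R then (1 : ℝ) else 0)| ≤ ∑ i, boundaryCount z R δ (x i) := by
    rw [← Finset.sum_sub_distrib]
    exact (Finset.abs_sum_le_sum_abs _ _).trans
      (Finset.sum_le_sum fun i _ => abs_ball_indicator_sub_le hyz)
  have h4 := abs_sub_le (∑ i, splitUtility q y x j i)
    (∑ i, (if |x i - y j| ≤ R then 1 - |x i - y j| else 0))
    (∑ i, (if |x i - z| ≤ R then 1 - |x i - z| else 0))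
  have h5 := abs_sub_le (⌊q j * n⌋₊ : ℝ) (∑ i, (if |x i - z| ≤ R then (1 : ℝ) else 0))
    (∑ i, (if |x i - y j| ≤ R then (1 : ℝ) else 0))
  rw [abs_sub_comm] at h3
  linarith

/-! ### Limits along a sequence of agents -/

section Deterministic

variable {ω : ℕ → ℝ}

theorem tendsto_floor_mul_div (c : ℝ) (hc : 0 ≤ c) :
    Tendsto (fun n : ℕ => (⌊c * ((n + 1 : ℕ) : ℝ)⌋₊ : ℝ) / ((n + 1 : ℕ) : ℝ)) atTop (𝓝 c) :=
  ((tendsto_nat_floor_mul_div_atTop hc).comp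
    (tendsto_natCast_atTop_atTop (R := ℝ))).comp (tendsto_add_atTop_nat 1)

theorem tendsto_floor_mul_div_succ (c : ℝ) (hc : 0 ≤ c) :
    Tendsto (fun n : ℕ => (⌊c * (n : ℝ)⌋₊ : ℝ) / ((n + 1 : ℕ) : ℝ)) atTop (𝓝 c) := by
  have h1 := (tendsto_nat_floor_mul_div_atTop hc).comp (tendsto_natCast_atTop_atTop (R := ℝ))
  have h2 := h1.mul (tendsto_natCast_div_add_atTop (1 : ℝ))
  rw [mul_one] at h2
  refine h2.congr' ?_
  filter_upwards [eventually_gt_atTop 0] with n hn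
  have : (n : ℝ) ≠ 0 := by exact_mod_cast hn.ne'
  simp only [Function.comp_apply]
  push_cast
  field_simp

/-- The empirical quantiles of a sequence with the right empirical frequencies converge. -/
theorem tendsto_percentileMechanism {m : ℕ} {μ : Measure ℝ} [IsProbabilityMeasure μ]
    [NullSingletonClass μ] (hsupp : μ.support = Set.Icc 0 1) {p : Fin m → ℝ} {j : Fin m}
    (hp : p j ∈ Set.Icc (0 : ℝ) 1) (hω : ∀ i, ω i ∈ Set.Icc (0 : ℝ) 1)
    (hfreq : ∀ t : ℚ, Tendsto (fun n : ℕ => (∑ i ∈ Finset.range n, if ω i ≤ t then (1 : ℝ) else 0) / n)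
      atTop (𝓝 (cdf μ t))) :
    Tendsto (fun n : ℕ => percentileMechanism p (fun i : Fin (n + 1) => ω i) j) atTop
      (𝓝 (quantile μ (p j))) := by
  have hmem : ∀ n : ℕ, percentileMechanism p (fun i : Fin (n + 1) => ω i) j ∈ Set.Icc (0 : ℝ) 1 := by
    intro n
    obtain ⟨i, hi⟩ := exists_percentileMechanism_eq p (fun i : Fin (n + 1) => ω i) j
    rw [hi]; exact hω i
  have hiff : ∀ (n : ℕ) (t : ℝ), percentileMechanism p (fun i : Fin (n + 1) => ω i) j ≤ t ↔
      (⌊p j * (n : ℝ)⌋₊ : ℝ) / ((n + 1 : ℕ) : ℝ) <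
        (∑ i ∈ Finset.range (n + 1), if ω i ≤ t then (1 : ℝ) else 0) / ((n + 1 : ℕ) : ℝ) := by
    intro n t
    rw [percentileMechanism_le_iff hp.2, div_lt_div_iff_of_pos_right (by positivity),
      ← Fin.sum_univ_eq_sum_range (fun i => if ω i ≤ t then (1 : ℝ) else 0), ← Finset.sum_filter,
      Finset.sum_const, nsmul_one, Nat.cast_lt]
  -- Below the quantile `F < p j` and above it `F > p j`, both strictly, so the frequencies at
  -- rational points eventually decide the comparison. Bounds outside `[0, 1]` are trivial.
  have hq := quantile_mem_Icc hsupp (p := p j) hp.2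
  rw [tendsto_order]
  constructor
  · intro a ha
    rcases lt_or_ge a 0 with ha0 | ha0
    · exact Eventually.of_forall fun n => ha0.trans_le (hmem n).1
    obtain ⟨t, hat, htq⟩ := exists_rat_btwn ha
    have hF := cdf_lt_of_lt_quantile (μ := μ) (p := p j) (t := t)
      ⟨by linarith, by linarith [hq.2]⟩ htq
    filter_upwards [((hfreq t).comp (tendsto_add_atTop_nat 1)).eventually_lt
      (tendsto_floor_mul_div_succ (p j) hp.1) hF] with n hn
    refine hat.trans (not_le.1 fun h => ?_)
    rw [hiff] at h
    exact lt_asymm h hn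
  · intro b hb
    rcases lt_or_ge 1 b with hb1 | hb1
    · exact Eventually.of_forall fun n => (hmem n).2.trans_lt hb1
    obtain ⟨t, hqt, htb⟩ := exists_rat_btwn hb
    have hF := lt_cdf_of_quantile_lt hsupp hp.2 (t := t) (by linarith) hqt
    filter_upwards [(tendsto_floor_mul_div_succ (p j) hp.1).eventually_lt
      ((hfreq t).comp (tendsto_add_atTop_nat 1)) hF] with n hn
    exact ((hiff n t).2 hn).trans_lt htb

/-- The welfare generated by one facility converges along a sequence with the right empirical
frequencies. -/
theorem tendsto_sum_splitUtility {m : ℕ} {q : Fin m → ℝ} {j : Fin m}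
    (hq : 0 ≤ q j) (hq1 : q j ≤ 1) (hω : ∀ i, ω i ∈ Set.Icc (0 : ℝ) 1)
    {y : ℕ → Fin m → ℝ} (hy : ∀ n, y n j ∈ Set.Icc (0 : ℝ) 1) {z R I : ℝ}
    (hz : z ∈ Set.Icc (0 : ℝ) 1)
    (hyz : Tendsto (fun n => y n j) atTop (𝓝 z)) {B : ℝ → ℝ}
    (hball : Tendsto (fun n : ℕ =>
      (∑ i ∈ Finset.range n, if |ω i - z| ≤ R then (1 : ℝ) else 0) / n) atTop (𝓝 (q j)))
    (hwel : Tendsto (fun n : ℕ =>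
      (∑ i ∈ Finset.range n, if |ω i - z| ≤ R then 1 - |ω i - z| else 0) / n) atTop (𝓝 I))
    (hbd : ∀ k : ℕ, Tendsto (fun n : ℕ =>
      (∑ i ∈ Finset.range n, boundaryCount z R (1 / ((k : ℝ) + 1)) (ω i)) / n) atTop
      (𝓝 (B (1 / ((k : ℝ) + 1)))))
    (hB : Tendsto B (𝓝 0) (𝓝 0)) :
    Tendsto (fun n : ℕ => (∑ i, splitUtility q (y n) (fun i : Fin (n + 1) => ω i) j i) /
      ((n + 1 : ℕ) : ℝ)) atTop (𝓝 I) := by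
  have hdist : ∀ {s t : ℝ}, s ∈ Set.Icc (0 : ℝ) 1 → t ∈ Set.Icc (0 : ℝ) 1 → |s - t| ≤ 1 := by
    intro s t hs ht
    rw [abs_le]; constructor <;> linarith [hs.1, hs.2, ht.1, ht.2]
  have hwel' := hwel.comp (tendsto_add_atTop_nat 1)
  have hball' := hball.comp (tendsto_add_atTop_nat 1)
  suffices h : Tendsto (fun n : ℕ =>
      (∑ i, splitUtility q (y n) (fun i : Fin (n + 1) => ω i) j i) / ((n + 1 : ℕ) : ℝ) -
      (∑ i ∈ Finset.range (n + 1), if |ω i - z| ≤ R then 1 - |ω i - z| else 0) / ((n + 1 : ℕ) : ℝ))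
      atTop (𝓝 0) by
    have := h.add hwel'
    simp only [Function.comp_apply, sub_add_cancel, zero_add] at this
    exact this
  rw [Metric.tendsto_atTop']
  suffices h : ∀ η > 0, ∀ᶠ n : ℕ in atTop, dist
      ((∑ i, splitUtility q (y n) (fun i : Fin (n + 1) => ω i) j i) / ((n + 1 : ℕ) : ℝ) -
      (∑ i ∈ Finset.range (n + 1), if |ω i - z| ≤ R then 1 - |ω i - z| else 0) / ((n + 1 : ℕ) : ℝ))
      0 < η by
    intro η hη
    obtain ⟨N, hN⟩ := eventually_atTop.1 (h η hη)
    exact ⟨N, fun n hn => hN n hn.le⟩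
  intro η hη
  have hk0 : Tendsto (fun k : ℕ => 1 / ((k : ℝ) + 1)) atTop (𝓝 0) :=
    tendsto_one_div_add_atTop_nhds_zero_nat
  -- The width `δ = 1 / (k + 1)` is fixed first so that the limiting error `2 * B δ + δ` is below
  -- `η`; only then does `n` grow.
  have hk1 : Tendsto (fun k : ℕ => 2 * B (1 / ((k : ℝ) + 1)) + 1 / ((k : ℝ) + 1)) atTop (𝓝 0) := by
    simpa using ((hB.comp hk0).const_mul 2).add hk0
  obtain ⟨k, hk⟩ := (hk1.eventually_lt_const hη).exists
  have hup : Tendsto (fun n : ℕ => |(⌊q j * ((n + 1 : ℕ) : ℝ)⌋₊ : ℝ) / ((n + 1 : ℕ) : ℝ) -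
      (∑ i ∈ Finset.range (n + 1), if |ω i - z| ≤ R then (1 : ℝ) else 0) / ((n + 1 : ℕ) : ℝ)| +
      (2 * ((∑ i ∈ Finset.range (n + 1), boundaryCount z R (1 / ((k : ℝ) + 1)) (ω i)) /
        ((n + 1 : ℕ) : ℝ)) + 1 / ((k : ℝ) + 1))) atTop
      (𝓝 (2 * B (1 / ((k : ℝ) + 1)) + 1 / ((k : ℝ) + 1))) := by
    have := (((tendsto_floor_mul_div (q j) hq).sub hball').abs).add
      ((((hbd k).comp (tendsto_add_atTop_nat 1)).const_mul 2).add_const (1 / ((k : ℝ) + 1)))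
    simpa using this
  have hclose : ∀ᶠ n in atTop, |y n j - z| ≤ 1 / ((k : ℝ) + 1) := by
    have := (Metric.tendsto_nhds.1 hyz) (1 / ((k : ℝ) + 1)) (by positivity)
    filter_upwards [this] with n hn
    rw [Real.dist_eq] at hn
    exact hn.le
  filter_upwards [hup.eventually_lt_const hk, hclose] with n hn hc
  rw [Real.dist_eq, sub_zero]
  refine lt_of_le_of_lt ?_ hn
  have hpos : (0 : ℝ) < ((n + 1 : ℕ) : ℝ) := by positivity
  have hcap : ⌊q j * ((n + 1 : ℕ) : ℝ)⌋₊ ≤ n + 1 :=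
    Nat.floor_le_of_le (mul_le_of_le_one_left hpos.le hq1)
  have h := abs_sum_splitUtility_sub_le q (y n) (fun i : Fin (n + 1) => ω i) j
    (fun i => hdist (hω i) (hy n)) hcap R (fun i => hdist (hω i) hz) hc
  rw [Fin.sum_univ_eq_sum_range (fun i => if |ω i - z| ≤ R then 1 - |ω i - z| else 0),
    Fin.sum_univ_eq_sum_range (fun i => if |ω i - z| ≤ R then (1 : ℝ) else 0),
    Fin.sum_univ_eq_sum_range (fun i => boundaryCount z R (1 / ((k : ℝ) + 1)) (ω i))] at h
  rw [← sub_div, ← sub_div, abs_div, abs_div, abs_of_pos hpos]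
  rw [div_le_iff₀ hpos]
  refine h.trans (le_of_eq ?_)
  field_simp

end Deterministic

/-! ### Samples -/

section Sample

theorem ae_mem_Ioo {μ : Measure ℝ} [NullSingletonClass μ] (hsupp : μ.support = Set.Icc 0 1) :
    ∀ᵐ x ∂μ, x ∈ Set.Ioo (0 : ℝ) 1 := by
  have h1 : ∀ᵐ x ∂μ, x ∈ Set.Icc (0 : ℝ) 1 := measure_compl_Icc_eq_zero hsupp
  have h2 : ∀ᵐ x ∂μ, x ≠ (0 : ℝ) := by
    rw [ae_iff]; simp
  have h3 : ∀ᵐ x ∂μ, x ≠ (1 : ℝ) := by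
    rw [ae_iff]; simp
  filter_upwards [h1, h2, h3] with x hx hx0 hx1
  exact ⟨lt_of_le_of_ne hx.1 hx0.symm, lt_of_le_of_ne hx.2 hx1⟩

variable {μ : Measure ℝ} [IsProbabilityMeasure μ]

/-- The strong law on the infinite product, where samples of all sizes live on one probability
space. -/
theorem tendsto_average_ae {f : ℝ → ℝ} (hf : Measurable f) (hint : Integrable f μ) :
    ∀ᵐ ω ∂(Measure.infinitePi fun _ : ℕ => μ),
      Tendsto (fun n : ℕ => (∑ i ∈ Finset.range n, f (ω i)) / n) atTop (𝓝 (∫ x, f x ∂μ)) := by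
  have hmp : ∀ i : ℕ, MeasurePreserving (Function.eval i)
      (Measure.infinitePi fun _ : ℕ => μ) μ := fun i => measurePreserving_eval_infinitePi _ i
  have h := strong_law_ae_real (μ := Measure.infinitePi fun _ : ℕ => μ)
    (fun i ω => f (ω i)) ((hmp 0).integrable_comp_of_integrable hint) ?_ ?_
  · have he : ∫ ω, f (ω 0) ∂(Measure.infinitePi fun _ : ℕ => μ) = ∫ x, f x ∂μ := by
      conv_rhs => rw [← (hmp 0).map_eq]
      rw [integral_map (hmp 0).measurable.aemeasurable hf.aestronglyMeasurable]
    rw [he] at h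
    exact h
  · intro i k hik
    exact (iIndepFun_infinitePi (P := fun _ : ℕ => μ) (X := fun _ x => f x)
      (fun _ => hf)).indepFun hik
  · intro i
    refine ⟨(hf.comp (measurable_pi_apply i)).aemeasurable,
      (hf.comp (measurable_pi_apply 0)).aemeasurable, ?_⟩
    have hmap : ∀ i : ℕ, (Measure.infinitePi fun _ : ℕ => μ).map (fun ω => f (ω i)) = μ.map f := by
      intro i
      conv_rhs => rw [← (hmp i).map_eq]
      rw [Measure.map_map hf (hmp i).measurable]
      rfl
    rw [hmap, hmap]

theorem ae_infinitePi_mem_Ioo {ι : Type*} [Countable ι] [NullSingletonClass μ]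
    (hsupp : μ.support = Set.Icc 0 1) :
    ∀ᵐ ω ∂(Measure.infinitePi fun _ : ι => μ), ∀ i, ω i ∈ Set.Ioo (0 : ℝ) 1 := by
  rw [ae_all_iff]
  intro i
  exact (measurePreserving_eval_infinitePi (fun _ : ι => μ) i).quasiMeasurePreserving.ae
    (ae_mem_Ioo hsupp)

/-- Two coordinates have joint law `μ.prod μ`, for which the diagonal is null as `μ` has no atoms;
there are countably many pairs. -/
theorem ae_infinitePi_injective {ι : Type*} [Countable ι] [NullSingletonClass μ] :
    ∀ᵐ ω ∂(Measure.infinitePi fun _ : ι => μ), Function.Injective ω := by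
  have h : ∀ i k : ι, ∀ᵐ ω ∂(Measure.infinitePi fun _ : ι => μ), ω i = ω k → i = k := by
    intro i k
    by_cases hik : i = k
    · exact Eventually.of_forall fun _ _ => hik
    have hmap := Measure.infinitePi_map_eval_prod (P := fun _ : ι => μ) hik
    have hdiag : ∀ᵐ z ∂(μ.prod μ), z ∈ (Set.diagonal ℝ)ᶜ := by
      rw [Measure.ae_prod_mem_iff_ae_ae_mem measurableSet_diagonal.compl]
      refine Eventually.of_forall fun x => ?_
      rw [ae_iff]
      simp
    rw [← hmap] at hdiag
    filter_upwards [ae_of_ae_map (by fun_prop) hdiag] with ω hω heq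
    exact absurd heq hω
  filter_upwards [ae_all_iff.2 fun i => ae_all_iff.2 (h i)] with ω hω i k
  exact hω i k

end Sample

/-! ### Almost sure limits and passage to expectations -/

section Limit

theorem integral_ite_one {μ : Measure ℝ} {S : Set ℝ} [DecidablePred (· ∈ S)] (hS : MeasurableSet S) :
    ∫ x, (if x ∈ S then (1 : ℝ) else 0) ∂μ = μ.real S := by
  rw [← integral_indicator_one hS]
  congr 1
  ext x
  simp [Set.indicator_apply]

variable {μ : Measure ℝ} [IsProbabilityMeasure μ]

theorem measurable_ite_one {S : Set ℝ} [DecidablePred (· ∈ S)] (hS : MeasurableSet S) :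
    Measurable fun x => if x ∈ S then (1 : ℝ) else 0 :=
  Measurable.ite hS measurable_const measurable_const

theorem integrable_ite_one {S : Set ℝ} [DecidablePred (· ∈ S)] (hS : MeasurableSet S) :
    Integrable (fun x => if x ∈ S then (1 : ℝ) else 0) μ := by
  refine Integrable.of_bound (measurable_ite_one hS).aestronglyMeasurable 1
    (Eventually.of_forall fun x => ?_)
  split_ifs <;> simp

theorem tendsto_frequency_ae {S : Set ℝ} [DecidablePred (· ∈ S)] (hS : MeasurableSet S) :
    ∀ᵐ ω ∂(Measure.infinitePi fun _ : ℕ => μ),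
      Tendsto (fun n : ℕ => (∑ i ∈ Finset.range n, if ω i ∈ S then (1 : ℝ) else 0) / n) atTop
        (𝓝 (μ.real S)) := by
  rw [← integral_ite_one hS]
  exact tendsto_average_ae (measurable_ite_one hS) (integrable_ite_one hS)

theorem measurable_boundaryCount (z R δ : ℝ) : Measurable (boundaryCount z R δ) := by
  unfold boundaryCount
  exact (Measurable.ite (measurableSet_le (by fun_prop) measurable_const)
    measurable_const measurable_const).add (Measurable.ite (measurableSet_le (by fun_prop)
    measurable_const) measurable_const measurable_const)

theorem abs_sub_le_iff_mem_Icc {x z R : ℝ} : |x - z| ≤ R ↔ x ∈ Set.Icc (z - R) (z + R) := by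
  rw [abs_le, Set.mem_Icc]; constructor <;> rintro ⟨h1, h2⟩ <;> constructor <;> linarith

open Classical in
theorem integral_boundaryCount [NullSingletonClass μ] (z R : ℝ) {δ : ℝ} (hδ : 0 ≤ δ) :
    Integrable (boundaryCount z R δ) μ ∧ ∫ x, boundaryCount z R δ x ∂μ =
      (cdf μ (z - R + δ) - cdf μ (z - R - δ)) + (cdf μ (z + R + δ) - cdf μ (z + R - δ)) := by
  have h : boundaryCount z R δ = fun x =>
      (if x ∈ Set.Icc (z - R - δ) (z - R + δ) then (1 : ℝ) else 0) +
        (if x ∈ Set.Icc (z + R - δ) (z + R + δ) then (1 : ℝ) else 0) := by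
    ext x
    simp only [boundaryCount, abs_sub_le_iff_mem_Icc]
  rw [h]
  refine ⟨(integrable_ite_one measurableSet_Icc).add (integrable_ite_one measurableSet_Icc), ?_⟩
  rw [integral_add (integrable_ite_one measurableSet_Icc) (integrable_ite_one measurableSet_Icc),
    integral_ite_one measurableSet_Icc, integral_ite_one measurableSet_Icc,
    measureReal_Icc_eq_cdf_sub (by linarith), measureReal_Icc_eq_cdf_sub (by linarith)]

theorem integral_ball_welfare (z R : ℝ) :
    Measurable (fun x => if |x - z| ≤ R then 1 - |x - z| else 0) ∧
    Integrable (fun x => if |x - z| ≤ R then 1 - |x - z| else 0) μ ∧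
    ∫ x, (if |x - z| ≤ R then 1 - |x - z| else 0) ∂μ =
      μ.real (Set.Icc (z - R) (z + R)) - ∫ x in Metric.closedBall z R, |x - z| ∂μ := by
  have hm : Measurable (fun x : ℝ => if |x - z| ≤ R then 1 - |x - z| else 0) :=
    Measurable.ite (measurableSet_le (by fun_prop) measurable_const) (by fun_prop) measurable_const
  refine ⟨hm, Integrable.of_bound hm.aestronglyMeasurable (1 + |R|)
    (Eventually.of_forall fun x => ?_), ?_⟩
  · have h0 := abs_nonneg (x - z)
    have h1 := abs_nonneg R
    have h2 := le_abs_self R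
    split_ifs
    · rw [Real.norm_eq_abs, abs_le]; constructor <;> linarith
    · rw [norm_zero]; linarith
  · have hint : IntegrableOn (fun x => |x - z|) (Metric.closedBall z R) μ := by
      refine IntegrableOn.of_bound (measure_lt_top _ _)
        (Continuous.aestronglyMeasurable (by fun_prop)) |R| ?_
      refine ae_restrict_of_forall_mem Metric.isClosed_closedBall.measurableSet fun x hx => ?_
      rw [Metric.mem_closedBall, Real.dist_eq] at hx
      rw [Real.norm_eq_abs, abs_abs]
      exact hx.trans (le_abs_self R)
    have h : (fun x : ℝ => if |x - z| ≤ R then 1 - |x - z| else 0) =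
        (Metric.closedBall z R).indicator fun x => 1 - |x - z| := by
      funext x
      by_cases hx : |x - z| ≤ R
      · rw [if_pos hx, Set.indicator_of_mem (by rwa [Metric.mem_closedBall, Real.dist_eq])]
      · rw [if_neg hx, Set.indicator_of_notMem (by rwa [Metric.mem_closedBall, Real.dist_eq])]
    rw [h, integral_indicator Metric.isClosed_closedBall.measurableSet,
      integral_sub (integrable_const _) hint, Real.closedBall_eq_Icc]
    simp

open Classical in
/-- Almost surely, the welfare generated by one facility of a percentile mechanism converges. -/
theorem tendsto_facility_welfare_ae [NullSingletonClass μ] (hsupp : μ.support = Set.Icc 0 1)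
    {m : ℕ} {p q : Fin m → ℝ} {j : Fin m} (hp : p j ∈ Set.Icc (0 : ℝ) 1) (hq : 0 ≤ q j)
    (hq1 : q j < 1) :
    ∀ᵐ ω ∂(Measure.infinitePi fun _ : ℕ => μ), Tendsto (fun n : ℕ =>
      (∑ i, splitUtility q (percentileMechanism p (fun i : Fin (n + 1) => ω i))
        (fun i : Fin (n + 1) => ω i) j i) / ((n + 1 : ℕ) : ℝ)) atTop
      (𝓝 (q j - ∫ x in Metric.closedBall (quantile μ (p j)) (radius μ (q j) (quantile μ (p j))),
        |x - quantile μ (p j)| ∂μ)) := by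
  have hz := quantile_mem_Icc hsupp (p := p j) hp.2
  set z := quantile μ (p j) with hzdef
  have hR : IsRadius μ (q j) z (radius μ (q j) z) :=
    (isRadius_iff_eq_radius hsupp hq hq1 hz _).2 rfl
  set R := radius μ (q j) z
  obtain ⟨hwm, hwi, hwe⟩ := integral_ball_welfare (μ := μ) z R
  rw [hR.2] at hwe
  have h1 := tendsto_average_ae hwm hwi
  have h2 := tendsto_frequency_ae (μ := μ) (measurableSet_Icc (a := z - R) (b := z + R))
  -- Widths `1 / (k + 1)` and rational thresholds suffice, so the exceptional sets form a countable
  -- family.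
  have h3 : ∀ᵐ ω ∂(Measure.infinitePi fun _ : ℕ => μ), ∀ k : ℕ, Tendsto (fun n : ℕ =>
      (∑ i ∈ Finset.range n, boundaryCount z R (1 / ((k : ℝ) + 1)) (ω i)) / n) atTop
      (𝓝 (∫ x, boundaryCount z R (1 / ((k : ℝ) + 1)) x ∂μ)) :=
    ae_all_iff.2 fun k => tendsto_average_ae (measurable_boundaryCount _ _ _)
      (integral_boundaryCount z R (by positivity)).1
  have h4 : ∀ᵐ ω ∂(Measure.infinitePi fun _ : ℕ => μ), ∀ t : ℚ, Tendsto (fun n : ℕ =>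
      (∑ i ∈ Finset.range n, if ω i ∈ Set.Iic (t : ℝ) then (1 : ℝ) else 0) / n) atTop
      (𝓝 (μ.real (Set.Iic (t : ℝ)))) :=
    ae_all_iff.2 fun t => tendsto_frequency_ae measurableSet_Iic
  filter_upwards [h1, h2, h3, h4, ae_infinitePi_mem_Ioo (ι := ℕ) hsupp] with ω h1 h2 h3 h4 h5
  have hω : ∀ i, ω i ∈ Set.Icc (0 : ℝ) 1 := fun i => Set.Ioo_subset_Icc_self (h5 i)
  rw [hwe] at h1
  rw [hR.2] at h2
  -- `B δ` is the mass within `δ` of the two end points, counted separately; it vanishes with `δ`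
  -- because `F` is continuous.
  refine tendsto_sum_splitUtility (z := z) (R := R)
    (B := fun δ => (cdf μ (z - R + δ) - cdf μ (z - R - δ)) +
      (cdf μ (z + R + δ) - cdf μ (z + R - δ))) hq hq1.le hω ?_ hz ?_ ?_ h1 ?_ ?_
  · intro n
    obtain ⟨i, hi⟩ := exists_percentileMechanism_eq p (fun i : Fin (n + 1) => ω i) j
    rw [hi]; exact hω i
  · refine tendsto_percentileMechanism hsupp hp hω fun t => ?_
    rw [cdf_eq_real]
    simpa only [Set.mem_Iic] using h4 t
  · simpa only [abs_sub_le_iff_mem_Icc] using h2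
  · intro k
    have := h3 k
    rwa [(integral_boundaryCount z R (by positivity)).2] at this
  · have hcont : Continuous fun δ => (cdf μ (z - R + δ) - cdf μ (z - R - δ)) +
        (cdf μ (z + R + δ) - cdf μ (z + R - δ)) := by
      have hF := continuous_cdf (μ := μ)
      exact ((hF.comp (by fun_prop)).sub (hF.comp (by fun_prop))).add
        ((hF.comp (by fun_prop)).sub (hF.comp (by fun_prop)))
    simpa using hcont.tendsto 0

/-- The welfare of the instance `x` when the facilities of the percentile mechanism serve their
closest agents independently of each other. -/
def splitWelfare {m n : ℕ} (p q : Fin m → ℝ) (x : Fin (n + 1) → ℝ) : ℝ :=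
  (∑ i, ∑ j, splitUtility q (percentileMechanism p x) x j i) / ((n + 1 : ℕ) : ℝ)

/-- The open interval matters: at distance exactly `1` an accommodated agent earns `0`, and its
choice would not be forced. -/
theorem abs_sub_percentileMechanism_lt_one {m n : ℕ} (p : Fin m → ℝ) {x : Fin (n + 1) → ℝ}
    (hx : ∀ i, x i ∈ Set.Ioo (0 : ℝ) 1) (i : Fin (n + 1)) (j : Fin m) :
    |x i - percentileMechanism p x j| < 1 := by
  obtain ⟨k, hk⟩ := exists_percentileMechanism_eq p x j
  rw [hk, abs_lt]
  constructor <;> linarith [(hx i).1, (hx i).2, (hx k).1, (hx k).2]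

theorem norm_splitWelfare_le {m n : ℕ} (p q : Fin m → ℝ) {x : Fin (n + 1) → ℝ}
    (hx : ∀ i, x i ∈ Set.Ioo (0 : ℝ) 1) : ‖splitWelfare p q x‖ ≤ m := by
  have hpos : (0 : ℝ) < ((n + 1 : ℕ) : ℝ) := by positivity
  unfold splitWelfare
  rw [norm_div, Real.norm_of_nonneg hpos.le, div_le_iff₀ hpos]
  have h : ∀ i j, ‖splitUtility q (percentileMechanism p x) x j i‖ ≤ 1 := by
    intro i j
    have h1 := abs_sub_percentileMechanism_lt_one p hx i j
    have h0 := abs_nonneg (x i - percentileMechanism p x j)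
    unfold splitUtility
    split_ifs
    · rw [Real.norm_eq_abs, abs_le]; constructor <;> linarith
    · simp
  calc ‖∑ i, ∑ j, splitUtility q (percentileMechanism p x) x j i‖
      ≤ ∑ i : Fin (n + 1), ∑ j : Fin m, (1 : ℝ) :=
        (norm_sum_le _ _).trans (Finset.sum_le_sum fun i _ =>
          (norm_sum_le _ _).trans (Finset.sum_le_sum fun j _ => h i j))
    _ = m * ((n + 1 : ℕ) : ℝ) := by simp [mul_comm]

theorem measurable_splitWelfare {m n : ℕ} {p : Fin m → ℝ} (q : Fin m → ℝ) (hp : ∀ j, p j ≤ 1) :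
    Measurable fun x : Fin (n + 1) → ℝ => splitWelfare p q x :=
  (Finset.measurable_sum _ fun i _ => Finset.measurable_sum _ fun j _ =>
    measurable_splitUtility (hp j) i).div_const _

theorem integrable_splitWelfare [NullSingletonClass μ] (hsupp : μ.support = Set.Icc 0 1) {m : ℕ}
    {p : Fin m → ℝ} (q : Fin m → ℝ) (hp : ∀ j, p j ≤ 1) (n : ℕ) :
    Integrable (fun x => splitWelfare p q x) (Measure.pi fun _ : Fin (n + 1) => μ) := by
  rw [← Measure.infinitePi_eq_pi]
  refine Integrable.of_bound (measurable_splitWelfare q hp).aestronglyMeasurable m ?_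
  filter_upwards [ae_infinitePi_mem_Ioo (ι := Fin (n + 1)) hsupp] with x hx
  exact norm_splitWelfare_le p q hx

theorem tendsto_integral_splitWelfare [NullSingletonClass μ] (hsupp : μ.support = Set.Icc 0 1)
    {m : ℕ} {p q : Fin m → ℝ} (hp : ∀ j, p j ∈ Set.Icc (0 : ℝ) 1) (hq : ∀ j, 0 ≤ q j)
    (hq1 : ∀ j, q j < 1) :
    Tendsto (fun n : ℕ => ∫ x, splitWelfare p q x ∂(Measure.pi fun _ : Fin (n + 1) => μ)) atTop
      (𝓝 (∑ j, (q j - ∫ x in Metric.closedBall (quantile μ (p j))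
        (radius μ (q j) (quantile μ (p j))), |x - quantile μ (p j)| ∂μ))) := by
  set L := ∑ j, (q j - ∫ x in Metric.closedBall (quantile μ (p j))
        (radius μ (q j) (quantile μ (p j))), |x - quantile μ (p j)| ∂μ)
  have hres : ∀ n : ℕ, Measurable fun (ω : ℕ → ℝ) (i : Fin (n + 1)) => ω i :=
    fun n => measurable_pi_lambda _ fun i => measurable_pi_apply _
  -- The sample of size `n + 1` is realised as the first coordinates of one infinite sample, so that
  -- pointwise limits make sense.
  have hint : ∀ n : ℕ, ∫ x, splitWelfare p q x ∂(Measure.pi fun _ : Fin (n + 1) => μ) =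
      ∫ ω, splitWelfare p q (fun i : Fin (n + 1) => ω i) ∂(Measure.infinitePi fun _ : ℕ => μ) := by
    intro n
    rw [← Measure.infinitePi_eq_pi, ← Measure.map_infinitePi_infinitePi_of_inj
      (P := fun _ : ℕ => μ) (f := fun i : Fin (n + 1) => (i : ℕ)) Fin.val_injective,
      integral_map (hres n).aemeasurable
        (measurable_splitWelfare q fun j => (hp j).2).aestronglyMeasurable]
  have hL : L = ∫ _ : ℕ → ℝ, L ∂(Measure.infinitePi fun _ : ℕ => μ) := by simp
  simp_rw [hint]
  rw [hL]
  refine tendsto_integral_of_dominated_convergence (fun _ => (m : ℝ)) ?_ (integrable_const _) ?_ ?_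
  · intro n
    exact ((measurable_splitWelfare q fun j => (hp j).2).comp (hres n)).aestronglyMeasurable
  · intro n
    filter_upwards [ae_infinitePi_mem_Ioo (ι := ℕ) hsupp] with ω hω
    exact norm_splitWelfare_le p q fun i => hω i
  · have h := ae_all_iff.2 fun j => tendsto_facility_welfare_ae hsupp (hp j) (hq j) (hq1 j)
    filter_upwards [h] with ω hω
    have hs := tendsto_finsetSum Finset.univ fun j _ => hω j
    refine hs.congr fun n => ?_
    unfold splitWelfare
    rw [Finset.sum_comm, Finset.sum_div]

/-- An agent among the closest of both facilities forces both capacities to be positive. Stability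
then separates the percentiles, in whichever order they come, and excludes such an agent. -/
theorem socialWelfare_eq_splitWelfare {n : ℕ} {p q : Fin 2 → ℝ} (hp : ∀ j, p j ∈ Set.Icc (0 : ℝ) 1)
    (hq : ∀ j, 0 ≤ q j) (hQ : q 0 + q 1 < 1) (hne : p 0 ≠ p 1)
    (hES : ∀ n : ℕ, IsEquilibriumStable q (percentileMechanism (n := n + 1) p))
    {x : Fin (n + 1) → ℝ} (hx : ∀ i, x i ∈ Set.Ioo (0 : ℝ) 1) (hinj : Function.Injective x)
    {s : Fin (n + 1) → Fin 2} (hs : IsNash q (percentileMechanism p x) x s) :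
    socialWelfare q (percentileMechanism p x) x s = splitWelfare p q x := by
  have hdisj : ∀ i a b, a ≠ b →
      fullRank (percentileMechanism p x) x a i < ⌊q a * (n + 1 : ℕ)⌋₊ →
      ¬ fullRank (percentileMechanism p x) x b i < ⌊q b * (n + 1 : ℕ)⌋₊ := by
    intro i a b hab ha hb
    have hqpos : ∀ j, j = a ∨ j = b → 0 < q j := by
      rintro j hj
      refine lt_of_le_of_ne (hq j) fun h0 => ?_
      rcases hj with rfl | rfl
      · rw [← h0] at ha; simp at ha
      · rw [← h0] at hb; simp at hb
    have hall : ∀ j, j = a ∨ j = b := by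
      intro j; fin_cases j <;> fin_cases a <;> fin_cases b <;> simp_all
    have hQ' : q a + q b < 1 := by
      fin_cases a <;> fin_cases b <;> simp_all; linarith
    have hne' : p a ≠ p b := by
      fin_cases a <;> fin_cases b <;> simp_all
      exact fun h => hne h.symm
    rcases lt_or_gt_of_ne hne' with hlt | hlt
    · exact not_fullRank_lt_percentileMechanism hp hq hQ'
        (le_percentile_sub_of_isEquilibriumStable hab (fun j => hqpos j (hall j)) hQ' hp hlt hES)
        hinj i ha hb
    · rw [add_comm] at hQ'
      exact not_fullRank_lt_percentileMechanism hp hq hQ'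
        (le_percentile_sub_of_isEquilibriumStable hab.symm (fun j => hqpos j (hall j)) hQ' hp hlt
          hES) hinj i hb ha
  unfold socialWelfare splitWelfare
  rw [Finset.sum_congr rfl fun i _ => utility_eq_of_isNash
    (abs_sub_percentileMechanism_lt_one p hx) hdisj hs i]

end Limit

end ScarceFLP

end

/-! ### Assembly of the theorem -/

theorem mainTheorem11
    (μ : Measure ℝ) [IsProbabilityMeasure μ] (hac : μ ≪ volume)
    (hsupp : μ.support = Set.Icc 0 1)
    (q : Fin 2 → ℝ) (hq : ∀ j, 0 ≤ q j) (hQ : q 0 + q 1 < 1) :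
    -- the one-facility radius functions are well defined
    (∀ j, ∀ y ∈ Set.Icc (0 : ℝ) 1, ∀ r,
      ScarceFLP.IsRadius μ (q j) y r ↔ r = ScarceFLP.radius μ (q j) y) ∧
    -- the two-facility radius function splits
    (∀ y : Fin 2 → ℝ, (∀ j, y j ∈ Set.Icc (0 : ℝ) 1) →
      cdf μ (y 1) - cdf μ (y 0) ≥ q 0 + q 1 →
      ScarceFLP.IsTwoRadius μ q y (fun j => ScarceFLP.radius μ (q j) (y j)) ∧
      ((∀ j, 0 < q j) → ∀ R : Fin 2 → ℝ, ScarceFLP.IsTwoRadius μ q y R →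
        R = fun j => ScarceFLP.radius μ (q j) (y j))) ∧
    -- the limit expected Social Welfare of Equilibrium Stable percentile mechanisms
    (∀ p : Fin 2 → ℝ, (∀ j, p j ∈ Set.Icc (0 : ℝ) 1) → p 0 ≠ p 1 →
      (∀ n : ℕ, ScarceFLP.IsEquilibriumStable q
        (ScarceFLP.percentileMechanism (n := n + 1) p)) →
      (∀ (n : ℕ), ∀ x ∈ ScarceFLP.cube (n + 1),
        ∃ s, ScarceFLP.IsNash q (ScarceFLP.percentileMechanism p x) x s) ∧
      ∀ γ : (n : ℕ) → (Fin (n + 1) → ℝ) → (Fin (n + 1) → Fin 2),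
        (∀ n, ∀ x ∈ ScarceFLP.cube (n + 1),
          ScarceFLP.IsNash q (ScarceFLP.percentileMechanism p x) x (γ n x)) →
        (∀ n, Integrable
          (fun x => ScarceFLP.socialWelfare q (ScarceFLP.percentileMechanism p x) x (γ n x))
          (Measure.pi fun _ : Fin (n + 1) => μ)) ∧
        Tendsto
          (fun n : ℕ => ∫ x, ScarceFLP.socialWelfare q
              (ScarceFLP.percentileMechanism p x) x (γ n x)
            ∂(Measure.pi fun _ : Fin (n + 1) => μ))
          atTop
          (𝓝 (q 0 + q 1 - ∑ j, ∫ x in Metric.closedBall (ScarceFLP.quantile μ (p j))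
              (ScarceFLP.radius μ (q j) (ScarceFLP.quantile μ (p j))),
            |x - ScarceFLP.quantile μ (p j)| ∂μ))) := by
  have : NullSingletonClass μ := ScarceFLP.nullSingletonClass_of_absolutelyContinuous hac
  have hq1 : ∀ j, q j < 1 := by
    intro j
    have h0 := hq 0
    have h1 := hq 1
    fin_cases j
    · exact lt_of_le_of_lt (le_add_of_nonneg_right h1) hQ
    · exact lt_of_le_of_lt (le_add_of_nonneg_left h0) hQ
  refine ⟨fun j y hy r => ScarceFLP.isRadius_iff_eq_radius hsupp (hq j) (hq1 j) hy r, ?_, ?_⟩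
  · intro y hy hF
    have hle : y 0 ≤ y 1 := ScarceFLP.le_of_cdf_sub_nonneg hsupp (hy 0) (hy 1)
      (by linarith [hq 0, hq 1])
    have hiff := fun j => ScarceFLP.isRadius_iff_eq_radius hsupp (hq j) (hq1 j) (hy j)
    unfold ScarceFLP.IsTwoRadius
    simp only [hle, if_true]
    refine ⟨ScarceFLP.isOrderedTwoRadius_radius hsupp hQ (hq 0) (hy 0) (hy 1) hle hF
      ((hiff 0 _).2 rfl) ((hiff 1 _).2 rfl), fun hpos R hR => ?_⟩
    obtain ⟨h0, h1⟩ := ScarceFLP.isRadius_of_isOrderedTwoRadius hsupp hQ (hpos 0) (hpos 1)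
      (hy 0) (hy 1) hF hR
    funext j
    fin_cases j
    · exact (hiff 0 _).1 h0
    · exact (hiff 1 _).1 h1
  · intro p hp hne hES
    refine ⟨fun n x hx => ScarceFLP.exists_isNash q _ x fun i j => ?_, fun γ hγ => ?_⟩
    · obtain ⟨k, hk⟩ := ScarceFLP.exists_percentileMechanism_eq p x j
      rw [hk, abs_le]
      constructor <;> linarith [(hx i).1, (hx i).2, (hx k).1, (hx k).2]
    -- The selection `γ` need not be measurable. Almost every instance has distinct positions in the
    -- open interval, and there the welfare equals `splitWelfare`; integrability and the limit pass
    -- over from it.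
    have hae : ∀ n : ℕ, (fun x => ScarceFLP.socialWelfare q (ScarceFLP.percentileMechanism p x) x
        (γ n x)) =ᵐ[Measure.pi fun _ : Fin (n + 1) => μ]
        fun x => ScarceFLP.splitWelfare p q x := by
      intro n
      rw [← Measure.infinitePi_eq_pi]
      filter_upwards [ScarceFLP.ae_infinitePi_mem_Ioo (ι := Fin (n + 1)) hsupp,
        ScarceFLP.ae_infinitePi_injective (μ := μ) (ι := Fin (n + 1))] with x hx hinj
      exact ScarceFLP.socialWelfare_eq_splitWelfare hp hq hQ hne hES hx hinj
        (hγ n x fun i => Set.Ioo_subset_Icc_self (hx i))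
    refine ⟨fun n => (ScarceFLP.integrable_splitWelfare hsupp q (fun j => (hp j).2) n).congr
      (hae n).symm, ?_⟩
    have hlim := ScarceFLP.tendsto_integral_splitWelfare hsupp hp hq hq1
    rw [Finset.sum_sub_distrib, Fin.sum_univ_two q] at hlim
    exact hlim.congr fun n => integral_congr_ae (hae n).symm
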